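/- Let $g,k,n\ge 0$ be integers and let $\boldsymbol\mu=(\mu^1,\dots,\mu^k)$ be a $k$-tuple of partitions of $n$, $\mu^i=(\mu^i_1\ge\mu^i_2\ge\cdots)$. Put $$\Delta(\boldsymbol\mu)=\tfrac12(2g-2+k)n^2-\tfrac12\sum_{i,j}(\mu^i_j)^2,\qquad \delta(\boldsymbol\mu)=(2g-2+k)n-\sum_{i=1}^k\mu^i_1 .$$ For a partition $\lambda$ of $n$ let $n(\lambda)=\sum_i(i-1)\lambda_i$, let $H_\lambda(q)=\prod_{s\in\lambda}(1-q^{h(s)})$ be the hook polynomial ($h(s)$ the hook length of the cell $s$), and let $$\mathcal A_{\lambda\boldsymbol\mu}(q)=q^{(1-g)n}\left(q^{-n(\lambda)}H_\lambda(q)\right)^{2g+k-2}\prod_{i=1}^k\left\langle h_{\mu^i}(\mathbf x_i),\,s_\lambda(\mathbf x_i\mathbf y)\right\rangle ,$$ where $\langle\cdot,\cdot\rangle$ is the Hall pairing on symmetric functions in infinitely many variables, $h_\mu$ and $s_\lambda$ are the complete and the Schur symmetric functions, and $\mathbf x\mathbf y$ is the set of variables $x_iy_j$ ($i,j\ge1$)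 with $y_j=q^{j-1}$; $\mathcal A_{\lambda\boldsymbol\mu}(q)$ is expanded as a Laurent series in $q$ over $\mathbb Q$. Let $v(\lambda)\in\mathbb Z$ be the $q$-adic valuation of $\mathcal A_{\lambda\boldsymbol\mu}(q)$. Let $\Gamma$ be the comet-shaped quiver with $g$ loops at a central vertex $0$ and $k$ legs with vertices $[i,1],\dots,[i,l(\mu^i)-1]$ ($l(\mu^i)$ the number of parts of $\mu^i$; no vertices if $l(\mu^i)\le 1$), and let $\mathbf v$ be its dimension vector $v_0=n$, $v_{[i,j]}=n-\sum_{r=1}^j\mu^i_r$. The quiver $\Gamma$, which is connected, is affine if its Tits form is positive semidefinite but not positive definite; its basic positive imaginary root $\mathbf v^*$ is then the vector such that the positive imaginary roots of $\Gamma$ (in the sense of Kac) are exactly the vectors $t\mathbf v^*$, $t\ge1$ an integer. Assume $\delta(\boldsymbol\mu)\ge0$. Then $\mathcal A_{\lambda\boldsymbol\mu}(q)\ne0$ for every partition $\lambda$ of $n$, and: (i) The minimum of $v(\lambda)$ over all partitions $\lambda$ of $n$ is $v((1^n))=-\Delta(\boldsymbol\mu)$. (ii) Case I: if $\Gamma$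 is affine and $\mathbf v=t\mathbf v^*$ for an integer $t\ge1$, then $t\mid n$ and the minimum is reached exactly at the partitions $\lambda$ that are the union of $n/t$ copies of some partition $\lambda_0$ of $t$. Case II: otherwise, the minimum is reached only at $\lambda=(1^n)$. -/

import Mathlib

namespace SymFun

/-! ### Partitions -/

section Partitions

variable {n : ℕ}

/-- The parts `λ_1 ≥ λ_2 ≥ …` of a partition, in weakly decreasing order. -/
def rows (lam : n.Partition) : List ℕ := lam.parts.sort (· ≥ ·)

theorem rows_sortedGE (lam : n.Partition) : (rows lam).SortedGE :=
  List.sortedGE_iff_pairwise.2 (Multiset.pairwise_sort _ _)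

/-- The part with (zero-based) index `j`; it is `0` beyond the length. -/
def part (lam : n.Partition) (j : ℕ) : ℕ := (rows lam).getD j 0

/-- The Young diagram of a partition; row `i` has `part lam i` cells. -/
def diagram (lam : n.Partition) : YoungDiagram :=
  YoungDiagram.ofRowLens (rows lam) (rows_sortedGE lam)

/-- `n(λ) = ∑ (i - 1) λ_i`, `i` counted from `1`. -/
def nStat (lam : n.Partition) : ℕ := ∑ i ∈ Finset.range (rows lam).length, i * part lam i

/-- The partition `(1^n)`. -/
def ones (n : ℕ) : n.Partition := Nat.Partition.ofSums n (Multiset.replicate n 1) (by simp)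

/-- Hook length of the cell `(i, j)`: arm plus leg plus one. -/
def hookLength (D : YoungDiagram) (c : ℕ × ℕ) : ℕ :=
  (D.rowLen c.1 - (c.2 + 1)) + (D.colLen c.2 - (c.1 + 1)) + 1

/-- The exponent vector of the monomial `x^λ = x_0^{λ_1} x_1^{λ_2} ⋯`. -/
noncomputable def exponent (lam : n.Partition) : ℕ →₀ ℕ := (rows lam).toFinsupp

end Partitions

/-! ### Symmetric functions in infinitely many variables

Symmetric functions are formal power series in variables `x_0, x_1, …`. -/

section SymmetricFunctions

open Finset

variable (K : Type*) [Field K]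

/-- The complete symmetric function `h_r` in the variables `x_0, x_1, …`: the sum of all monomials
of degree `r`. -/
noncomputable def completeH (r : ℕ) : MvPowerSeries ℕ K := fun d => if d.degree = r then 1 else 0

open Classical in
/-- The power sum `p_r = ∑ x_i ^ r`. -/
noncomputable def powerSum (r : ℕ) : MvPowerSeries ℕ K :=
  fun d => if ∃ i, d = Finsupp.single i r then 1 else 0

/-- `h_ν = ∏ h_{ν_j}` for a partition `ν`. -/
noncomputable def completeHPart {n : ℕ} (ν : n.Partition) : MvPowerSeries ℕ K :=
  (ν.parts.map (completeH K)).prod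

variable {K}

theorem coeff_completeH (r : ℕ) (d : ℕ →₀ ℕ) :
    MvPowerSeries.coeff d (completeH K r) = if d.degree = r then 1 else 0 := rfl

open Classical in
theorem coeff_powerSum (r : ℕ) (d : ℕ →₀ ℕ) :
    MvPowerSeries.coeff d (powerSum K r) = if ∃ i, d = Finsupp.single i r then 1 else 0 := rfl

theorem coeff_powerSum_mul (r : ℕ) (d : ℕ →₀ ℕ) (f : MvPowerSeries ℕ K) :
    MvPowerSeries.coeff d (powerSum K (r + 1) * f) = ∑ i ∈ d.support,
      if r + 1 ≤ d i then MvPowerSeries.coeff (d - Finsupp.single i (r + 1)) f else 0 := by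
  classical
  rw [MvPowerSeries.coeff_mul, ← Finset.sum_filter]
  symm
  have hsub : (d.support.filter (fun i => r + 1 ≤ d i)).image
      (fun i => (Finsupp.single i (r + 1), d - Finsupp.single i (r + 1)))
      ⊆ antidiagonal d := by
    intro x hx
    simp only [mem_image, mem_filter] at hx
    obtain ⟨i, ⟨_, hi⟩, rfl⟩ := hx
    rw [Finset.HasAntidiagonal.mem_antidiagonal]
    exact add_tsub_cancel_of_le (Finsupp.single_le_iff.2 hi)
  rw [← Finset.sum_subset hsub, Finset.sum_image]
  · refine Finset.sum_congr rfl fun i _ => ?_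
    rw [coeff_powerSum, if_pos ⟨i, rfl⟩, one_mul]
  · intro i _ j _ hij
    exact Finsupp.single_left_injective (Nat.succ_ne_zero r) (congrArg Prod.fst hij)
  · rintro ⟨a, b⟩ hab hn
    rw [coeff_powerSum, if_neg, zero_mul]
    rintro ⟨i, hi⟩
    apply hn
    simp only at hi
    subst hi
    rw [Finset.HasAntidiagonal.mem_antidiagonal] at hab
    simp only at hab
    simp only [mem_image, mem_filter]
    refine ⟨i, ⟨?_, ?_⟩, ?_⟩
    · rw [Finsupp.mem_support_iff, ← hab]; simp
    · rw [← hab]; simp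
    · rw [← hab, add_tsub_cancel_left]

theorem newton (n : ℕ) :
    ((n : K) + 1) • completeH K (n + 1) =
      ∑ r ∈ range (n + 1), powerSum K (r + 1) * completeH K (n - r) := by
  ext d
  rw [map_sum, map_smul, coeff_completeH]
  simp_rw [coeff_powerSum_mul, coeff_completeH]
  rw [Finset.sum_comm]
  have hdeg : ∀ i r, r + 1 ≤ d i → (d - Finsupp.single i (r + 1)).degree + (r + 1) = d.degree := by
    intro i r hr
    conv_rhs => rw [← tsub_add_cancel_of_le (Finsupp.single_le_iff.2 hr)]
    simp
  split_ifs with h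
  · have : ∀ i ∈ d.support, (∑ r ∈ range (n + 1), if r + 1 ≤ d i then
        (if (d - Finsupp.single i (r + 1)).degree = n - r then (1 : K) else 0) else 0) = d i := by
      intro i _
      have hle : d i ≤ n + 1 := h ▸ Finsupp.le_degree i d
      rw [← Finset.sum_subset (s₁ := range (d i)) (Finset.range_subset_range.2 hle)]
      · rw [Finset.sum_congr rfl (g := fun _ => 1)]
        · simp
        · intro r hr
          have hr' : r + 1 ≤ d i := by simpa using hr
          have := hdeg i r hr'
          rw [if_pos hr', if_pos (by omega)]
      · intro r _ hr
        rw [if_neg (by simpa using hr)]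
    rw [Finset.sum_congr rfl this, ← Nat.cast_sum]
    have : ∑ i ∈ d.support, d i = n + 1 := h
    rw [this]; simp
  · symm
    rw [smul_zero]
    refine Finset.sum_eq_zero fun i _ => Finset.sum_eq_zero fun r hr => ?_
    split_ifs with h1 h2
    · have := hdeg i r h1
      have : r ≤ n := by simpa [Nat.lt_succ_iff] using hr
      omega
    · rfl
    · rfl

/-- The multiset of nonzero values of an exponent vector. -/
def vals (d : ℕ →₀ ℕ) : Multiset ℕ := d.support.val.map d

theorem vals_erase (d : ℕ →₀ ℕ) (i : ℕ) (hi : i ∈ d.support) :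
    vals d = d i ::ₘ vals (d.erase i) := by
  classical
  unfold vals
  rw [Finsupp.support_erase, ← Finset.insert_erase hi, Finset.insert_val_of_notMem (by simp)]
  rw [Finset.insert_erase hi, Multiset.map_cons]
  congr 1
  refine Multiset.map_congr rfl fun j hj => ?_
  have : j ≠ i := (Finset.mem_erase.1 hj).1
  rw [Finsupp.erase_ne this]

theorem exists_vals (s : Multiset ℕ) (hs : ∀ a ∈ s, 0 < a) : ∃ d, vals d = s := by
  induction s using Multiset.induction with
  | empty => exact ⟨0, by simp [vals]⟩
  | cons a s ih =>
    obtain ⟨d, hd⟩ := ih fun b hb => hs b (Multiset.mem_cons_of_mem hb)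
    obtain ⟨i, hi⟩ := Infinite.exists_notMem_finset d.support
    have ha : a ≠ 0 := (hs a (Multiset.mem_cons_self a s)).ne'
    have hdi : d i = 0 := by simpa using hi
    refine ⟨d + Finsupp.single i a, ?_⟩
    rw [vals_erase _ i (by simp [ha]), Finsupp.erase_add, Finsupp.erase_single, add_zero,
      Finsupp.erase_of_notMem_support hi, hd]
    simp [hdi]

theorem coeff_prod_powerSum (s : Multiset ℕ) : ∀ d : ℕ →₀ ℕ, ∃ N : ℕ,
    MvPowerSeries.coeff d (s.map fun i => powerSum K (i + 1)).prod = (N : K) ∧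
    (vals d = s.map (· + 1) → 0 < N) ∧
    (0 < N → (vals d).card ≤ s.card ∧ ((vals d).card = s.card → vals d = s.map (· + 1))) := by
  classical
  induction s using Multiset.induction with
  | empty =>
    intro d
    refine ⟨if d = 0 then 1 else 0, ?_, ?_, ?_⟩
    · simp [MvPowerSeries.coeff_one]
    · intro h
      have : d = 0 := by simpa [vals] using h
      simp [this]
    · intro h
      have : d = 0 := by by_contra hne; simp [hne] at h
      simp [this, vals]
  | cons a s ih =>
    intro d
    choose N h1 h2 h3 using ih
    refine ⟨∑ i ∈ d.support, if a + 1 ≤ d i then N (d - Finsupp.single i (a + 1)) else 0, ?_, ?_, ?_⟩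
    · rw [Multiset.map_cons, Multiset.prod_cons, coeff_powerSum_mul, Nat.cast_sum]
      refine Finset.sum_congr rfl fun i _ => ?_
      split_ifs <;> simp [h1]
    · intro h
      have hm : a + 1 ∈ vals d := by rw [h]; simp
      obtain ⟨i, hi, hia⟩ := Multiset.mem_map.1 hm
      have hi' : i ∈ d.support := hi
      refine lt_of_lt_of_le ?_ (Finset.single_le_sum (f := fun i =>
        if a + 1 ≤ d i then N (d - Finsupp.single i (a + 1)) else 0) (fun _ _ => Nat.zero_le _) hi')
      rw [if_pos hia.ge]
      apply h2
      have he : d - Finsupp.single i (a + 1) = d.erase i := by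
        ext j
        by_cases hj : j = i
        · subst hj; simp [hia]
        · simp [Finsupp.erase_ne hj, Finsupp.single_eq_of_ne hj]
      rw [he]
      have := vals_erase d i hi'
      rw [h, hia, Multiset.map_cons] at this
      exact ((Multiset.cons_inj_right _).1 this).symm
    · intro h
      obtain ⟨i, hi, hpos⟩ := Finset.sum_pos_iff.1 h
      split_ifs at hpos with hle
      · obtain ⟨hc, he⟩ := h3 _ hpos
        set d' := d - Finsupp.single i (a + 1) with hd'
        have hv := vals_erase d i hi
        have herase : d'.erase i = d.erase i := by
          ext j
          by_cases hj : j = i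
          · subst hj; simp
          · simp [Finsupp.erase_ne hj, hd', Finsupp.single_eq_of_ne hj]
        by_cases hi' : i ∈ d'.support
        · have hv' := vals_erase d' i hi'
          rw [herase] at hv'
          have hcard : (vals d).card = (vals d').card := by rw [hv, hv']; simp
          constructor
          · rw [hcard, Multiset.card_cons]; omega
          · intro hh; rw [hcard, Multiset.card_cons] at hh; omega
        · rw [Finsupp.erase_of_notMem_support hi'] at herase
          have hdi : d i = a + 1 := by
            have : d' i = 0 := by simpa using hi'
            have h0 : d i - (a + 1) = 0 := by simpa [hd'] using this
            omega
          rw [hv, ← herase, hdi]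
          simp only [Multiset.card_cons, Multiset.map_cons]
          refine ⟨by omega, fun hh => ?_⟩
          rw [he (by omega)]
      · exact absurd hpos (lt_irrefl _)

theorem aeval_monomial_eq (F : ℕ → MvPowerSeries ℕ K) (β : ℕ →₀ ℕ) (c : K) :
    MvPolynomial.aeval F (MvPolynomial.monomial β c) = c • (β.toMultiset.map F).prod := by
  rw [MvPolynomial.aeval_monomial, Algebra.smul_def]
  congr 1
  rw [Finsupp.toMultiset_apply, Finsupp.sum, ← Multiset.coe_mapAddMonoidHom, map_sum,
    Multiset.prod_sum]
  refine Finset.prod_congr rfl fun i _ => ?_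
  simp [Multiset.map_nsmul, Multiset.prod_nsmul]

theorem aeval_powerSum_injective [CharZero K] : Function.Injective
    (MvPolynomial.aeval (R := K) fun i => powerSum K (i + 1)) := by
  rw [injective_iff_map_eq_zero]
  intro f hf
  by_contra hne
  obtain ⟨α, hα, hmax⟩ := Finset.exists_max_image f.support
    (fun β => β.toMultiset.card) (MvPolynomial.support_nonempty.2 hne)
  obtain ⟨d, hd⟩ := exists_vals (α.toMultiset.map (· + 1)) (by simp)
  have h0 := congrArg (MvPowerSeries.coeff d) hf
  rw [f.as_sum, map_sum, map_sum, Finset.sum_eq_single_of_mem α hα] at h0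
  · rw [aeval_monomial_eq, map_smul] at h0
    obtain ⟨N, h1, h2, -⟩ := coeff_prod_powerSum (K := K) α.toMultiset d
    rw [h1] at h0
    have hN := h2 hd
    have : MvPolynomial.coeff α f ≠ 0 := MvPolynomial.mem_support_iff.1 hα
    simp [this, hN.ne'] at h0
  · intro β hβ hβα
    rw [aeval_monomial_eq, map_smul]
    obtain ⟨N, h1, -, h3⟩ := coeff_prod_powerSum (K := K) β.toMultiset d
    rcases Nat.eq_zero_or_pos N with hN | hN
    · rw [h1, hN]; simp
    · exfalso
      obtain ⟨hc, he⟩ := h3 hN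
      have hle := hmax β hβ
      have hcd : (vals d).card = α.toMultiset.card := by rw [hd]; simp
      have := he (by omega)
      rw [hd] at this
      have hab := Multiset.map_injective (add_left_injective 1) this
      apply hβα
      rw [← Finsupp.toMultiset_toFinsupp α, ← Finsupp.toMultiset_toFinsupp β, hab]

theorem exists_newton_inverse [CharZero K] : ∃ Q H : ℕ → MvPolynomial ℕ K,
    (∀ n : ℕ, ((n : K) + 1) • MvPolynomial.X n = Q n +
      ∑ r ∈ range n, Q r * MvPolynomial.X (n - r - 1)) ∧
    (∀ n : ℕ, ((n : K) + 1) • H n = MvPolynomial.X n +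
      ∑ r ∈ range n, MvPolynomial.X r * H (n - r - 1)) := by
  let Q : ℕ → MvPolynomial ℕ K := fun n => Nat.strongRec (motive := fun _ => MvPolynomial ℕ K)
    (fun (n : ℕ) ih => ((n : K) + 1) • MvPolynomial.X n - ∑ r : Fin n, ih r r.2 * MvPolynomial.X (n - r - 1)) n
  let H : ℕ → MvPolynomial ℕ K := fun n => Nat.strongRec (motive := fun _ => MvPolynomial ℕ K)
    (fun (n : ℕ) ih => ((n : K) + 1)⁻¹ • (MvPolynomial.X n + ∑ r : Fin n, MvPolynomial.X (r : ℕ) *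
      ih (n - r - 1) (by have := r.2; omega))) n
  refine ⟨Q, H, fun (n : ℕ) => ?_, fun (n : ℕ) => ?_⟩
  · have : Q n = ((n : K) + 1) • MvPolynomial.X n -
        ∑ r : Fin n, Q r * MvPolynomial.X (n - r - 1) := by
      simp only [Q]; rw [Nat.strongRec]
    rw [this, Finset.sum_range fun r => Q r * MvPolynomial.X (n - r - 1)]
    ring
  · have : H n = ((n : K) + 1)⁻¹ • (MvPolynomial.X n + ∑ r : Fin n, MvPolynomial.X (r : ℕ) *
        H (n - r - 1)) := by
      simp only [H]; rw [Nat.strongRec]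
    rw [Finset.sum_range fun r => MvPolynomial.X r * H (n - r - 1)]
    conv_lhs => rw [this]
    rw [smul_smul, mul_inv_cancel₀ (Nat.cast_add_one_ne_zero n), one_smul]

theorem aeval_completeH_injective [CharZero K] : Function.Injective
    (MvPolynomial.aeval (R := K) fun i => completeH K (i + 1)) := by
  obtain ⟨Q, H, hQ, hH⟩ := exists_newton_inverse (K := K)
  have hn : ∀ n : ℕ, ((n : K) + 1) ≠ 0 := Nat.cast_add_one_ne_zero
  have h1 : ∀ n, MvPolynomial.aeval (R := K) Q (H n) = MvPolynomial.X n := by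
    intro n
    induction n using Nat.strong_induction_on with
    | _ n ih =>
      have := congrArg (MvPolynomial.aeval (R := K) Q) (hH n)
      rw [map_smul, map_add, map_sum, MvPolynomial.aeval_X] at this
      rw [Finset.sum_congr rfl (g := fun r => Q r * MvPolynomial.X (n - r - 1)), ← hQ n] at this
      · exact smul_right_injective _ (hn n) this
      · intro r hr
        have : r < n := by simpa using hr
        rw [map_mul, MvPolynomial.aeval_X, ih _ (by omega)]
  have h2 : ∀ n, MvPolynomial.aeval (R := K) (fun i => completeH K (i + 1)) (Q n) =
      powerSum K (n + 1) := by
    intro n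
    induction n using Nat.strong_induction_on with
    | _ n ih =>
      have := congrArg (MvPolynomial.aeval (R := K) (fun i => completeH K (i + 1))) (hQ n)
      rw [map_smul, map_add, map_sum, MvPolynomial.aeval_X, newton, Finset.sum_range_succ,
        add_comm, Finset.sum_congr rfl (g := fun r => MvPolynomial.aeval (R := K)
          (fun i => completeH K (i + 1)) (Q r * MvPolynomial.X (n - r - 1)))] at this
      · have h0 : completeH K 0 = 1 := by
          ext d
          classical
          rw [coeff_completeH, MvPowerSeries.coeff_one]
          simp [Finsupp.degree_eq_zero_iff]
        rw [Nat.sub_self, h0, mul_one] at this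
        exact (add_right_cancel this).symm
      · intro r hr
        have : r < n := by simpa using hr
        rw [map_mul, MvPolynomial.aeval_X, ih r this]
        congr 2
        omega
  have h3 : ∀ f, MvPolynomial.aeval (R := K) Q (MvPolynomial.aeval (R := K) H f) = f := by
    intro f
    have : (MvPolynomial.aeval (R := K) Q).comp (MvPolynomial.aeval (R := K) H) =
        AlgHom.id K _ := MvPolynomial.algHom_ext fun i => by
      rw [AlgHom.comp_apply, MvPolynomial.aeval_X, h1, AlgHom.id_apply]
    exact DFunLike.congr_fun this f
  have h4 : ∀ f, MvPolynomial.aeval (R := K) (fun i => completeH K (i + 1))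
      (MvPolynomial.aeval (R := K) Q f) =
        MvPolynomial.aeval (R := K) (fun i => powerSum K (i + 1)) f := by
    intro f
    have : (MvPolynomial.aeval (R := K) (fun i => completeH K (i + 1))).comp
        (MvPolynomial.aeval (R := K) Q) =
          MvPolynomial.aeval (R := K) (fun i => powerSum K (i + 1)) :=
      MvPolynomial.algHom_ext fun i => by simp [h2]
    exact DFunLike.congr_fun this f
  rw [injective_iff_map_eq_zero]
  intro f hf
  rw [← h3 f, h4] at hf
  rw [← h3 f, (injective_iff_map_eq_zero _).1 aeval_powerSum_injective _ hf, map_zero]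

theorem linearIndependent_completeHPart [CharZero K] : LinearIndependent K
    (fun ν : Σ n : ℕ, n.Partition => completeHPart K ν.2) := by
  have hm : LinearIndependent K (fun ν : Σ n : ℕ, n.Partition =>
      MvPolynomial.monomial (R := K) (Multiset.toFinsupp (ν.2.parts.map Nat.pred)) 1) := by
    refine (MvPolynomial.basisMonomials ℕ K).linearIndependent.comp
      (fun ν : Σ n : ℕ, n.Partition => Multiset.toFinsupp (ν.2.parts.map Nat.pred)) ?_
    rintro ⟨m, ν⟩ ⟨n, κ⟩ h
    have hmap : ∀ {n : ℕ} (ν : n.Partition), (ν.parts.map Nat.pred).map Nat.succ = ν.parts := by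
      intro n ν
      rw [Multiset.map_map]
      conv_rhs => rw [← Multiset.map_id ν.parts]
      exact Multiset.map_congr rfl fun a ha => Nat.succ_pred_eq_of_pos (ν.parts_pos ha)
    have hp : ν.parts = κ.parts := by
      rw [← hmap ν, ← hmap κ, Multiset.toFinsupp.injective h]
    have hmn : m = n := by rw [← ν.parts_sum, ← κ.parts_sum, hp]
    subst hmn
    rw [Nat.Partition.ext hp]
  have := hm.map' (MvPolynomial.aeval (R := K) fun i => completeH K (i + 1)).toLinearMap
    (LinearMap.ker_eq_bot.2 aeval_completeH_injective)
  suffices e : (fun ν : Σ n : ℕ, n.Partition => completeHPart K ν.2) =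
      (MvPolynomial.aeval (R := K) fun i => completeH K (i + 1)).toLinearMap ∘
        fun ν : Σ n : ℕ, n.Partition =>
          MvPolynomial.monomial (R := K) (Multiset.toFinsupp (ν.2.parts.map Nat.pred)) 1 by
    rw [e]; exact this
  funext ν
  simp only [Function.comp_apply, AlgHom.toLinearMap_apply]
  rw [aeval_monomial_eq, one_smul, Multiset.toFinsupp_toMultiset, Multiset.map_map]
  unfold completeHPart
  congr 1
  refine Multiset.map_congr rfl fun a ha => ?_
  simp only [Function.comp_apply]
  rw [← Nat.succ_eq_add_one, Nat.succ_pred_eq_of_pos (ν.2.parts_pos ha)]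


theorem vals_exponent {n : ℕ} (ν : n.Partition) : vals (exponent ν) = ν.parts := by
  have hpos : ∀ a ∈ rows ν, 0 < a := fun a ha => ν.parts_pos (by
    rw [rows, Multiset.mem_sort] at ha; exact ha)
  have hsupp : (exponent ν).support = range (rows ν).length := by
    ext i
    rw [Finsupp.mem_support_iff, mem_range, exponent, List.toFinsupp_apply]
    constructor
    · intro h
      by_contra hi
      exact h (List.getD_eq_default _ _ (not_lt.1 hi))
    · intro hi
      rw [List.getD_eq_getElem _ _ hi]
      exact (hpos _ (List.getElem_mem hi)).ne'
  have hlist : (List.range (rows ν).length).map (exponent ν) = rows ν := by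
    refine List.ext_getElem (by simp) fun i h1 h2 => ?_
    rw [List.getElem_map, List.getElem_range, exponent, List.toFinsupp_apply,
      List.getD_eq_getElem _ _ h2]
  unfold vals
  rw [hsupp]
  change Multiset.map _ (↑(List.range (rows ν).length) : Multiset ℕ) = _
  rw [Multiset.map_coe, hlist]
  exact Multiset.sort_eq _ _

variable (K) in
open Classical in
/-- The monomial symmetric function `m_ν`: the sum of all monomials whose nonzero exponents are the
parts of `ν`. -/
noncomputable def monomialSym {n : ℕ} (ν : n.Partition) : MvPowerSeries ℕ K :=
  fun d => if vals d = ν.parts then 1 else 0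

open Classical in
/-- The Hall pairing `⟨f, g⟩`: the bilinear form for which the bases `(h_ν)` and `(m_ν)` are dual to
each other. Writing `f = ∑ a_ν h_ν` (the `h_ν` are linearly independent and span the symmetric
functions), `⟨f, g⟩ = ∑ a_ν b_ν`, where `b_ν` is the coefficient of `m_ν` in the symmetric function
`g`, that is, the coefficient of the monomial `x^ν` in `g`. -/
noncomputable def hallPairing [CharZero K] (f g : MvPowerSeries ℕ K) : K :=
  if hf : f ∈ Submodule.span K
      (Set.range fun ν : Σ n : ℕ, n.Partition => completeHPart K ν.2) then
    (linearIndependent_completeHPart.repr ⟨f, hf⟩).sum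
      fun ν a => a * MvPowerSeries.coeff (exponent ν.2) g
  else 0

theorem hallPairing_completeHPart [CharZero K] {n : ℕ} (ν : n.Partition)
    (g : MvPowerSeries ℕ K) :
    hallPairing (completeHPart K ν) g = MvPowerSeries.coeff (exponent ν) g := by
  have hf : completeHPart K ν ∈ Submodule.span K
      (Set.range fun ν : Σ n : ℕ, n.Partition => completeHPart K ν.2) :=
    Submodule.subset_span ⟨⟨n, ν⟩, rfl⟩
  rw [hallPairing, dif_pos hf,
    LinearIndependent.repr_eq_single linearIndependent_completeHPart ⟨n, ν⟩ ⟨_, hf⟩ rfl]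
  simp

/-- The duality of the bases `(h_ν)` and `(m_ν)`. -/
theorem hallPairing_completeHPart_monomialSym [CharZero K] {n : ℕ} (ν κ : n.Partition) :
    hallPairing (completeHPart K ν) (monomialSym K κ) = if ν = κ then 1 else 0 := by
  rw [hallPairing_completeHPart]
  change (if vals (exponent ν) = κ.parts then (1 : K) else 0) = _
  rw [vals_exponent]
  simp [Nat.Partition.ext_iff]

/-- The content of a tableau: the exponent of `i` is the number of cells with entry `i`. -/
noncomputable def content {D : YoungDiagram} (T : SemistandardYoungTableau D) : ℕ →₀ ℕ :=
  ∑ c ∈ D.cells, Finsupp.single (T c.1 c.2) 1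

/-- The Schur function `s_λ = ∑_T x^T`, over semistandard tableaux `T` of shape `λ`. -/
noncomputable def schur {n : ℕ} (lam : n.Partition) : MvPowerSeries ℕ ℚ :=
  fun d => (Nat.card {T : SemistandardYoungTableau (diagram lam) // content T = d} : ℚ)

/-- For a symmetric function `f`, the symmetric function `f(𝐱𝐲)` in `𝐱`, where `𝐱𝐲` is the set of
variables `x_i y_j` and `y_j = q^j` (`i, j ≥ 0`). The variables of `f` are indexed by pairs through
the bijection `ℕ × ℕ ≃ ℕ` (`f` being symmetric, any bijection gives the same result). The monomial
`∏ (x_i y_j)^{β(i,j)}` is `x^α q^m` with `α_i = ∑_j β(i,j)` and `m = ∑ j β(i,j)`, and for given `α`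
and `m` there are finitely many such `β`. -/
noncomputable def evalXY (f : MvPowerSeries ℕ ℚ) : MvPowerSeries ℕ (LaurentSeries ℚ) :=
  fun α => HahnSeries.ofPowerSeries ℤ ℚ <| PowerSeries.mk fun m =>
    ∑ᶠ β ∈ {β : ℕ × ℕ →₀ ℕ | β.mapDomain Prod.fst = α ∧ (β.sum fun p e => p.2 * e) = m},
      MvPowerSeries.coeff (β.equivMapDomain Nat.pairEquiv) f

end SymmetricFunctions

/-! ### The functions `𝒜_{λμ}(q)` -/

section CalA

instance : CharZero (LaurentSeries ℚ) := algebraRat.charZero _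

/-- The variable `q`, in the field `ℚ((q))` of Laurent series, which contains `ℚ(q)`. -/
noncomputable def qVar : LaurentSeries ℚ := HahnSeries.single 1 1

/-- The hook polynomial `H_λ(q) = ∏ (1 - q^{h(s)})`, over the cells `s` of `λ`. -/
noncomputable def hookPoly {n : ℕ} (lam : n.Partition) : LaurentSeries ℚ :=
  ∏ c ∈ (diagram lam).cells, (1 - qVar ^ hookLength (diagram lam) c)

/-- `𝒜_{λμ}(q) = q^{(1-g)|λ|} (q^{-n(λ)} H_λ(q))^{2g+k-2} ∏_i ⟨h_{μ^i}(𝐱_i), s_λ(𝐱_i 𝐲)⟩`. -/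
noncomputable def calA (g : ℕ) {k n : ℕ} (μ : Fin k → n.Partition) (lam : n.Partition) :
    LaurentSeries ℚ :=
  qVar ^ ((1 - (g : ℤ)) * n) *
    (qVar ^ (-(nStat lam : ℤ)) * hookPoly lam) ^ (2 * (g : ℤ) + k - 2) *
    ∏ i, hallPairing (completeHPart (LaurentSeries ℚ) (μ i)) (evalXY (schur lam))

/-- `v(λ)`, the `q`-adic valuation of `𝒜_{λμ}(q)`. -/
noncomputable def valuationA (g : ℕ) {k n : ℕ} (μ : Fin k → n.Partition) (lam : n.Partition) : ℤ :=
  (calA g μ lam).order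

/-- `δ(μ) = (2g-2+k) n - ∑_i μ^i_1`. -/
def smallDelta (g : ℕ) {k n : ℕ} (μ : Fin k → n.Partition) : ℤ :=
  (2 * (g : ℤ) - 2 + k) * n - ∑ i, (part (μ i) 0 : ℤ)

/-- `Δ(μ) = ½ (2g-2+k) n² - ½ ∑_{i,j} (μ^i_j)²`. -/
def bigDelta (g : ℕ) {k n : ℕ} (μ : Fin k → n.Partition) : ℚ :=
  (1 / 2) * (2 * (g : ℚ) - 2 + k) * n ^ 2 -
    (1 / 2) * ∑ i, ∑ j ∈ Finset.range (rows (μ i)).length, (part (μ i) j : ℚ) ^ 2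

end CalA

end SymFun

/-! ### Quivers, roots, affine type -/

/-- A finite quiver with vertex set `I`. -/
structure FinQuiver (I : Type) where
  /-- The set of arrows. -/
  Arrow : Type
  /-- There are finitely many arrows. -/
  fintypeArrow : Fintype Arrow
  /-- The head of an arrow. -/
  head : Arrow → I
  /-- The tail of an arrow. -/
  tail : Arrow → I

namespace FinQuiver

variable {I : Type} [Fintype I] [DecidableEq I] (Q : FinQuiver I)

/-- The number of arrows joining `i` and `j`, in either direction. -/
noncomputable def numEdges (i j : I) : ℕ :=
  Nat.card {a : Q.Arrow // (Q.tail a = i ∧ Q.head a = j) ∨ (Q.tail a = j ∧ Q.head a = i)}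

/-- The Cartan matrix of a quiver. -/
noncomputable def cartan : Matrix I I ℤ :=
  fun i j => if i = j then 2 - 2 * (Q.numEdges i i : ℤ) else -(Q.numEdges i j : ℤ)

/-- The underlying simple graph: distinct vertices are adjacent if some arrow joins them. -/
def graph : SimpleGraph I := SimpleGraph.fromRel fun i j => ∃ a, Q.tail a = i ∧ Q.head a = j

/-- The (doubled) Tits form `ᵗx C x`. -/
noncomputable def titsForm (x : I → ℤ) : ℤ := x ⬝ᵥ Q.cartan.mulVec x

/-- The quiver is of affine type: it is connected and its Tits form is positive semidefinite, but
not positive definite. -/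
def IsAffine : Prop :=
  Q.graph.Connected ∧ (∀ x, 0 ≤ Q.titsForm x) ∧ ∃ x, x ≠ 0 ∧ Q.titsForm x = 0

/-- The fundamental set of imaginary roots: nonzero dimension vectors with connected support that
pair nonpositively, in the Cartan pairing, with every coordinate vector. -/
def IsFundamental (u : I → ℤ) : Prop :=
  (∀ i, 0 ≤ u i) ∧ u ≠ 0 ∧ (Q.graph.induce {i | u i ≠ 0}).Connected ∧
    ∀ i, Q.cartan.mulVec u i ≤ 0

/-- The fundamental reflection at a vertex `i`. -/
noncomputable def reflect (i : I) (u : I → ℤ) : I → ℤ := u - Pi.single i (Q.cartan.mulVec u i)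

/-- The positive imaginary roots: the images of the fundamental set under the Weyl group, which is
generated by the reflections at the vertices without loops. -/
inductive IsPosImaginaryRoot : (I → ℤ) → Prop
  | fundamental (u : I → ℤ) (hu : Q.IsFundamental u) : IsPosImaginaryRoot u
  | reflection (i : I) (hi : Q.numEdges i i = 0) (u : I → ℤ) (hu : IsPosImaginaryRoot u) :
      IsPosImaginaryRoot (Q.reflect i u)

/-- `u` is the basic positive imaginary root: the positive imaginary roots are the multiples `t u`,
`t ≥ 1`. -/
def IsBasicImaginaryRoot (u : I → ℤ) : Prop :=
  ∀ w : I → ℤ, Q.IsPosImaginaryRoot w ↔ ∃ t : ℕ, 1 ≤ t ∧ w = t • u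

end FinQuiver

namespace SymFun

/-- The legs of the quiver of `μ`: the pair `⟨i, j⟩` stands for the vertex `[i, j + 1]`, and the
`i`-th leg has length `l(μ^i) - 1`. -/
abbrev Leg {k n : ℕ} (μ : Fin k → n.Partition) : Type :=
  Σ i : Fin k, Fin ((rows (μ i)).length - 1)

/-- The vertices of the quiver of `μ`: the central vertex `none` and the vertices on the legs. -/
abbrev CometVertex {k n : ℕ} (μ : Fin k → n.Partition) : Type := Option (Leg μ)

/-- The comet-shaped quiver of `μ`: `g` loops at the central vertex, and an arrow from every vertex
on a leg to the preceding one (the central vertex precedes the first vertex of each leg). -/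
def cometQuiver (g : ℕ) {k n : ℕ} (μ : Fin k → n.Partition) : FinQuiver (CometVertex μ) where
  Arrow := Fin g ⊕ Leg μ
  fintypeArrow := inferInstance
  tail
    | Sum.inl _ => none
    | Sum.inr p => some p
  head
    | Sum.inl _ => none
    | Sum.inr ⟨_, ⟨0, _⟩⟩ => none
    | Sum.inr ⟨i, ⟨j + 1, hj⟩⟩ => some ⟨i, ⟨j, Nat.lt_of_succ_lt hj⟩⟩

/-- The dimension vector of `μ`: `v_0 = n` and `v_{[i,j]} = n - (μ^i_1 + ⋯ + μ^i_j)`. -/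
def dimVector {k n : ℕ} (μ : Fin k → n.Partition) : CometVertex μ → ℤ
  | none => n
  | some ⟨i, j⟩ => n - ∑ r ∈ Finset.range ((j : ℕ) + 1), (part (μ i) r : ℤ)

end SymFun

/-!
The pairing `⟨h_μ, s_λ(𝐱𝐲)⟩` is the generating function in `q` of the semistandard tableaux of shape
`λ` in the variables `x_i q^j` whose content in the `x_i` is `μ`, so nothing cancels and its
valuation `m` is a minimum over tableaux. Let `x_{p,s}` be the number of `j` such that `x_p q^j`
fills more than `s` cells of a minimizing tableau. Then `∑_s x_{p,s} = μ_p` and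
`∑_{p,s} x_{p,s}² ≤ 2 m + n`, while dominance gives `⟨λ, λ⟩ = ∑_s (λ'_s)² ≤ ∑_s (∑_p x_{p,s})²`.
The elementary inequality `n ∑_p μ_p² + μ_1 ⟨λ, λ⟩ ≤ μ_1 n² + n (2 m + n)` follows by completing
squares, and summing it over the `μ^i` gives `2 n (v(λ) - v((1^n))) ≥ δ(μ) (n² - ⟨λ, λ⟩) ≥ 0`.
Equality away from `(1^n)` forces `δ(μ) = 0`, every `μ^i` to be rectangular, and every `λ'_s` to be
divisible by every `l(μ^i)`.

On the quiver side the Cartan matrix sends `𝐯` to `-δ(μ)` at the centre and to the differences of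
consecutive parts of `μ^i` on the legs, so these conditions on `μ` say that `𝐯` is in the radical of
the Tits form. A positive vector in the radical makes the form positive semidefinite, and `𝐯^*` is
the primitive one, whose central value is the least common multiple of the `l(μ^i)`.
-/

namespace SymFun

open Finset

/-! ### Young diagrams -/

theorem two_mul_sum_range_add (a : ℕ) : 2 * ∑ i ∈ range a, i + a = a ^ 2 := by
  rw [mul_comm, sum_range_id_mul_two, Nat.mul_sub_one, sq]
  exact Nat.sub_add_cancel (Nat.le_mul_self a)

section YoungDiagram

variable {M : Type*} [AddCommMonoid M] (D : YoungDiagram)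

theorem sum_cells_filter_snd_lt (r : ℕ) (f : ℕ × ℕ → M) :
    ∑ c ∈ D.cells with c.2 < r, f c = ∑ s ∈ range r, ∑ i ∈ range (D.colLen s), f (i, s) :=
  Finset.sum_finset_product_right _ _ _ fun c => by
    rw [mem_filter, YoungDiagram.mem_cells, mem_range, mem_range,
      ← YoungDiagram.mem_iff_lt_colLen, and_comm]

theorem snd_lt_card {D : YoungDiagram} {c : ℕ × ℕ} (hc : c ∈ D.cells) : c.2 < D.cells.card := by
  have hrow : D.rowLen c.1 ≤ D.cells.card := by
    rw [YoungDiagram.rowLen_eq_card]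
    exact card_le_card (filter_subset _ _)
  exact (YoungDiagram.mem_iff_lt_rowLen.1 ((YoungDiagram.mem_cells c).1 hc)).trans_le hrow

theorem sum_cells_eq_sum_columns {r : ℕ} (hr : D.cells.card ≤ r) (f : ℕ × ℕ → M) :
    ∑ c ∈ D.cells, f c = ∑ s ∈ range r, ∑ i ∈ range (D.colLen s), f (i, s) := by
  rw [← sum_cells_filter_snd_lt, filter_true_of_mem fun c hc => (snd_lt_card hc).trans_le hr]

theorem card_filter_snd_lt (r : ℕ) : #{c ∈ D.cells | c.2 < r} = ∑ s ∈ range r, D.colLen s := by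
  rw [card_eq_sum_ones, sum_cells_filter_snd_lt]
  simp only [sum_const, card_range, smul_eq_mul, mul_one]

theorem sum_colLen {r : ℕ} (hr : D.cells.card ≤ r) :
    ∑ s ∈ range r, D.colLen s = D.cells.card := by
  rw [card_eq_sum_ones, sum_cells_eq_sum_columns D hr]
  simp only [sum_const, card_range, smul_eq_mul, mul_one]

theorem two_mul_sum_fst_add_card {r : ℕ} (hr : D.cells.card ≤ r) :
    2 * ∑ c ∈ D.cells, c.1 + D.cells.card = ∑ s ∈ range r, D.colLen s ^ 2 := by
  rw [sum_cells_eq_sum_columns D hr, ← sum_colLen D hr, mul_sum, ← sum_add_distrib]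
  exact sum_congr rfl fun s _ => two_mul_sum_range_add _

end YoungDiagram

/-! ### Partitions and their diagrams -/

section PartitionDiagram

variable {n : ℕ} (lam : n.Partition)

theorem coe_rows : (rows lam : Multiset ℕ) = lam.parts :=
  Multiset.sort_eq _ _

theorem part_of_lt {i : ℕ} (hi : i < (rows lam).length) : part lam i = (rows lam)[i] :=
  List.getD_eq_getElem _ _ hi

theorem part_of_le {i : ℕ} (hi : (rows lam).length ≤ i) : part lam i = 0 :=
  List.getD_eq_default _ _ hi

theorem part_pos_iff {i : ℕ} : 0 < part lam i ↔ i < (rows lam).length := by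
  refine ⟨fun h => ?_, fun h => ?_⟩
  · by_contra hi
    exact h.ne' (part_of_le lam (not_lt.1 hi))
  · rw [part_of_lt lam h]
    exact lam.parts_pos (by rw [← coe_rows]; exact List.getElem_mem h)

theorem mem_diagram {i j : ℕ} : (i, j) ∈ diagram lam ↔ j < part lam i := by
  rw [diagram, YoungDiagram.mem_ofRowLens]
  refine ⟨fun ⟨hi, hj⟩ => by rwa [part_of_lt lam hi], fun h => ?_⟩
  have hi := (part_pos_iff lam).1 (Nat.zero_lt_of_lt h)
  exact ⟨hi, by rwa [part_of_lt lam hi] at h⟩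

theorem rowLen_diagram (i : ℕ) : (diagram lam).rowLen i = part lam i :=
  eq_of_forall_lt_iff fun j => by rw [← YoungDiagram.mem_iff_lt_rowLen, mem_diagram]

theorem part_anti : Antitone (part lam) := fun i j h => by
  rw [← rowLen_diagram, ← rowLen_diagram]
  exact YoungDiagram.rowLen_anti _ _ _ h

theorem sum_cells_diagram {M : Type*} [AddCommMonoid M] (f : ℕ × ℕ → M) :
    ∑ c ∈ (diagram lam).cells, f c =
      ∑ i ∈ range (rows lam).length, ∑ j ∈ range (part lam i), f (i, j) :=
  Finset.sum_finset_product _ _ _ fun c => by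
    rw [YoungDiagram.mem_cells, mem_diagram, mem_range, mem_range, ← part_pos_iff]
    exact ⟨fun h => ⟨Nat.zero_lt_of_lt h, h⟩, And.right⟩

theorem sum_map_parts {M : Type*} [AddCommMonoid M] (f : ℕ → M) :
    ∑ i ∈ range (rows lam).length, f (part lam i) = (lam.parts.map f).sum := by
  rw [← coe_rows, Multiset.map_coe, Multiset.sum_coe, Finset.sum_range, ← Fin.sum_univ_fun_getElem]
  exact sum_congr rfl fun i _ => by rw [part_of_lt lam i.2]

theorem sum_part : ∑ i ∈ range (rows lam).length, part lam i = n := by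
  simpa [lam.parts_sum] using sum_map_parts lam id

theorem part_le (i : ℕ) : part lam i ≤ n := by
  rcases lt_or_ge i (rows lam).length with hi | hi
  · exact (single_le_sum (fun _ _ => Nat.zero_le _) (mem_range.2 hi)).trans_eq (sum_part lam)
  · simp [part_of_le lam hi]

theorem card_diagram : (diagram lam).cells.card = n := by
  rw [card_eq_sum_ones, sum_cells_diagram]
  simp only [sum_const, card_range, smul_eq_mul, mul_one, sum_part]

theorem sum_colLen_diagram : ∑ s ∈ range n, (diagram lam).colLen s = n := by
  rw [sum_colLen _ (card_diagram lam).le, card_diagram]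

theorem colLen_diagram_eq_card (s : ℕ) :
    (diagram lam).colLen s = #{i ∈ range (rows lam).length | s < part lam i} := by
  rw [← card_range ((diagram lam).colLen s)]
  congr 1
  ext i
  rw [mem_range, mem_filter, mem_range, ← YoungDiagram.mem_iff_lt_colLen, mem_diagram,
    ← part_pos_iff]
  exact ⟨fun h => ⟨Nat.zero_lt_of_lt h, h⟩, And.right⟩

theorem colLen_diagram (s : ℕ) : (diagram lam).colLen s = lam.parts.countP (s < ·) := by
  rw [colLen_diagram_eq_card, card_filter, sum_map_parts lam fun a => if s < a then 1 else 0]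
  induction lam.parts using Multiset.induction with
  | empty => rfl
  | cons a t ih => rw [Multiset.map_cons, Multiset.sum_cons, ih, Multiset.countP_cons, add_comm]

theorem count_parts_add_colLen (r : ℕ) :
    lam.parts.count (r + 1) + (diagram lam).colLen (r + 1) = (diagram lam).colLen r := by
  rw [colLen_diagram, colLen_diagram]
  induction lam.parts using Multiset.induction with
  | empty => rfl
  | cons a t ih =>
    rw [Multiset.count_cons, Multiset.countP_cons, Multiset.countP_cons, ← ih]
    split_ifs <;> omega

theorem eq_of_colLen_eq {lam κ : n.Partition}
    (h : ∀ s, (diagram lam).colLen s = (diagram κ).colLen s) : lam = κ := by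
  ext r
  rcases r with - | r
  · rw [Multiset.count_eq_zero.2 fun h => (lam.parts_pos h).false,
      Multiset.count_eq_zero.2 fun h => (κ.parts_pos h).false]
  · have h1 := count_parts_add_colLen lam r
    rw [h, h, ← count_parts_add_colLen κ r] at h1
    exact Nat.add_right_cancel h1

theorem exponent_apply (p : ℕ) : exponent lam p = part lam p :=
  List.toFinsupp_apply _ _

theorem support_exponent : (exponent lam).support = range (rows lam).length := by
  ext p
  rw [Finsupp.mem_support_iff, exponent_apply, mem_range, ← part_pos_iff, Nat.pos_iff_ne_zero]

end PartitionDiagram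

section ColNormSq

variable {n : ℕ}

/-- `⟨λ, λ⟩ = ∑_s (λ'_s)²`, the sum of the squares of the column lengths; a partition of `n` has at
most `n` columns. -/
def colNormSq (lam : n.Partition) : ℕ := ∑ s ∈ range n, (diagram lam).colLen s ^ 2

theorem two_mul_nStat_add (lam : n.Partition) : 2 * nStat lam + n = colNormSq lam := by
  have hsum : ∑ c ∈ (diagram lam).cells, c.1 = nStat lam := by
    simp [sum_cells_diagram, nStat, mul_comm]
  have h := two_mul_sum_fst_add_card (diagram lam) (card_diagram lam).le
  rwa [hsum, card_diagram] at h

theorem parts_ones (n : ℕ) : (ones n).parts = Multiset.replicate n 1 := by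
  rw [ones, Nat.Partition.ofSums_parts, Multiset.filter_eq_self]
  intro a ha
  rw [Multiset.eq_of_mem_replicate ha]
  exact one_ne_zero

theorem colLen_ones (n s : ℕ) : (diagram (ones n)).colLen s = if s = 0 then n else 0 := by
  rw [colLen_diagram, parts_ones]
  split_ifs with h
  · rw [Multiset.countP_eq_card.2 fun a ha => ?_, Multiset.card_replicate]
    rw [h, Multiset.eq_of_mem_replicate ha]
    exact one_pos
  · refine Multiset.countP_eq_zero.2 fun a ha hs => h ?_
    rwa [Multiset.eq_of_mem_replicate ha, Nat.lt_one_iff] at hs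

theorem colNormSq_ones (n : ℕ) : colNormSq (ones n) = n ^ 2 := by
  rw [colNormSq, sum_eq_single 0]
  · rw [colLen_ones, if_pos rfl]
  · intro s _ hs
    rw [colLen_ones, if_neg hs, zero_pow two_ne_zero]
  · intro h
    rw [colLen_ones, if_pos rfl, Nat.eq_zero_of_not_pos (mt mem_range.2 h), zero_pow two_ne_zero]

theorem colNormSq_le_colLen_zero_mul (lam : n.Partition) :
    colNormSq lam ≤ (diagram lam).colLen 0 * n := by
  calc ∑ s ∈ range n, (diagram lam).colLen s ^ 2
      ≤ ∑ s ∈ range n, (diagram lam).colLen 0 * (diagram lam).colLen s :=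
        sum_le_sum fun s _ => by
          rw [sq]; exact Nat.mul_le_mul_right _ (YoungDiagram.colLen_anti _ _ _ (Nat.zero_le _))
    _ = (diagram lam).colLen 0 * n := by rw [← mul_sum, sum_colLen_diagram]

theorem eq_ones_of_le_colLen_zero {lam : n.Partition} (h : n ≤ (diagram lam).colLen 0) :
    lam = ones n := by
  refine eq_of_colLen_eq fun s => ?_
  have hsum := sum_colLen (diagram lam) ((card_diagram lam).trans_le (Nat.le_add_right n (s + 1)))
  rw [card_diagram, ← add_assoc, sum_range_succ'] at hsum
  rw [colLen_ones]
  rcases s with - | s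
  · rw [if_pos rfl]
    omega
  · have hle := single_le_sum (f := fun i => (diagram lam).colLen (i + 1))
      (fun _ _ => Nat.zero_le _) (mem_range.2 (show s < n + (s + 1) by omega))
    rw [if_neg s.succ_ne_zero]
    omega

theorem eq_ones_of_colNormSq {lam : n.Partition} (h : colNormSq lam = n ^ 2) : lam = ones n := by
  rcases Nat.eq_zero_or_pos n with rfl | hn
  · exact Subsingleton.elim _ _
  · have hle := colNormSq_le_colLen_zero_mul lam
    rw [h, sq] at hle
    exact eq_ones_of_le_colLen_zero (Nat.le_of_mul_le_mul_right hle hn)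

end ColNormSq

/-! ### Exponent vectors -/

section ColCount

variable {ι κ : Type*}

/-- The number of indices at which `d` exceeds `s`. If the nonzero values of `d` are the parts of a
partition, these are its column lengths. -/
def colCount (d : ι →₀ ℕ) (s : ℕ) : ℕ := #{v ∈ d.support | s < d v}

theorem sum_sum_filter_lt (d : ι →₀ ℕ) (r : ℕ) (w : ι → ℕ) :
    ∑ s ∈ range r, ∑ v ∈ d.support with s < d v, w v = ∑ v ∈ d.support, min (d v) r * w v := by
  have hcard (a : ℕ) : #{s ∈ range r | s < a} = min a r := by
    rw [← card_range (min a r)]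
    congr 1
    ext s
    rw [mem_filter, mem_range, mem_range, lt_min_iff, and_comm]
  simp_rw [sum_filter]
  rw [sum_comm]
  exact sum_congr rfl fun v _ => by rw [← sum_filter, sum_const, smul_eq_mul, hcard]

theorem sum_colCount_eq_sum_min (d : ι →₀ ℕ) (r : ℕ) :
    ∑ s ∈ range r, colCount d s = ∑ v ∈ d.support, min (d v) r := by
  simpa only [colCount, card_eq_sum_ones, mul_one] using sum_sum_filter_lt d r fun _ => 1

theorem sum_colCount (d : ι →₀ ℕ) {r : ℕ} (hr : d.degree ≤ r) :
    ∑ s ∈ range r, colCount d s = d.degree := by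
  rw [sum_colCount_eq_sum_min, Finsupp.degree]
  exact sum_congr rfl fun v _ => min_eq_left ((Finsupp.le_degree v d).trans hr)

theorem colCount_equivMapDomain (e : ι ≃ κ) (d : ι →₀ ℕ) (s : ℕ) :
    colCount (d.equivMapDomain e) s = colCount d s := by
  rw [colCount, colCount, ← card_map e.toEmbedding]
  congr 1
  ext w
  rw [mem_map_equiv, mem_filter, mem_filter, Finsupp.mem_support_iff, Finsupp.mem_support_iff,
    Finsupp.equivMapDomain_apply]

theorem sum_range_card_le_sum (S : Finset ℕ) : ∑ i ∈ range #S, i ≤ ∑ j ∈ S, j := by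
  have h := Finset.sum_range_le_sum (s := S.map Nat.castEmbedding) (c := 0) (by simp)
  simp only [card_map, sum_map, Nat.castEmbedding_apply, zero_add] at h
  zify
  exact h

theorem sum_colCount_sq_le (d : ℕ →₀ ℕ) {r : ℕ} (hr : d.degree ≤ r) :
    ∑ s ∈ range r, colCount d s ^ 2 ≤ 2 * (d.sum fun j e => j * e) + d.degree := by
  have hsum : (d.sum fun j e => j * e) = ∑ s ∈ range r, ∑ v ∈ d.support with s < d v, v := by
    rw [sum_sum_filter_lt, Finsupp.sum]
    exact sum_congr rfl fun v _ => by
      rw [min_eq_left ((Finsupp.le_degree v d).trans hr), mul_comm]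
  rw [hsum, ← sum_colCount d hr, mul_sum, ← sum_add_distrib]
  refine sum_le_sum fun s _ => ?_
  rw [← two_mul_sum_range_add]
  exact Nat.add_le_add_right (Nat.mul_le_mul_left 2 (sum_range_card_le_sum _)) _

theorem sum_support_eq_sum_curry {M : Type*} [AddCommMonoid M] (β : ι × κ →₀ ℕ) {P : Finset ι}
    (hP : ∀ v ∈ β.support, v.1 ∈ P) (f : ι → κ → ℕ → M) :
    ∑ v ∈ β.support, f v.1 v.2 (β v) =
      ∑ p ∈ P, ∑ j ∈ (β.curry p).support, f p j (β.curry p j) :=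
  Finset.sum_finset_product _ _ _ fun v => by
    rw [Finsupp.mem_support_iff (f := β.curry v.1), Finsupp.curry_apply]
    exact ⟨fun hv => ⟨hP v hv, Finsupp.mem_support_iff.1 hv⟩,
      fun hv => Finsupp.mem_support_iff.2 hv.2⟩

theorem colCount_eq_sum_curry (β : ι × κ →₀ ℕ) {P : Finset ι} (hP : ∀ v ∈ β.support, v.1 ∈ P)
    (s : ℕ) : colCount β s = ∑ p ∈ P, colCount (β.curry p) s := by
  simp_rw [colCount, card_filter]
  exact sum_support_eq_sum_curry β hP fun _ _ e => if s < e then 1 else 0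

theorem mapDomain_fst_apply (β : ι × κ →₀ ℕ) (p : ι) :
    β.mapDomain Prod.fst p = (β.curry p).degree := by
  classical
  induction β using Finsupp.induction_linear with
  | zero => exact (map_zero Finsupp.degree).symm
  | add f g hf hg =>
    rw [Finsupp.mapDomain_add, Finsupp.add_apply, hf, hg, ← map_add]
    exact congrArg Finsupp.degree (Finsupp.ext fun _ => rfl)
  | single v e =>
    rw [Finsupp.mapDomain_single, Finsupp.curry_single, Finsupp.single_apply, Finsupp.single_apply]
    split_ifs <;> simp

theorem fst_mem_support_of_mapDomain {β : ι × κ →₀ ℕ} {a : ι →₀ ℕ}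
    (h : β.mapDomain Prod.fst = a) {v : ι × κ} (hv : v ∈ β.support) : v.1 ∈ a.support := by
  rw [← h, Finsupp.mem_support_iff, mapDomain_fst_apply]
  exact ((Nat.pos_of_ne_zero (Finsupp.mem_support_iff.1 hv)).trans_le
    (Finsupp.le_degree v.2 (β.curry v.1))).ne'

end ColCount

/-! ### Dominance for contents of semistandard tableaux -/

section Dominance

theorem mul_sum_range_le_sum_mul {R : Type*} [CommRing R] [LinearOrder R] [IsStrictOrderedRing R]
    {u e : ℕ → R} (hu : Antitone u) (he : ∀ k, 0 ≤ ∑ s ∈ range k, e s) (k : ℕ) :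
    u k * ∑ s ∈ range k, e s ≤ ∑ s ∈ range k, u s * e s := by
  induction k with
  | zero => simp
  | succ k ih =>
    calc u (k + 1) * ∑ s ∈ range (k + 1), e s
        ≤ u k * ∑ s ∈ range (k + 1), e s :=
          mul_le_mul_of_nonneg_right (hu k.le_succ) (he (k + 1))
      _ = u k * ∑ s ∈ range k, e s + u k * e k := by rw [sum_range_succ, mul_add]
      _ ≤ ∑ s ∈ range (k + 1), u s * e s := by rw [sum_range_succ]; gcongr

theorem sum_sq_add_sum_sq_sub_le_of_dominates {R : Type*} [CommRing R] [LinearOrder R]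
    [IsStrictOrderedRing R] {r : ℕ} {u c : ℕ → R} (hu : Antitone u)
    (hdom : ∀ k, ∑ s ∈ range k, u s ≤ ∑ s ∈ range k, c s)
    (htot : ∑ s ∈ range r, u s = ∑ s ∈ range r, c s) :
    ∑ s ∈ range r, u s ^ 2 + ∑ s ∈ range r, (c s - u s) ^ 2 ≤ ∑ s ∈ range r, c s ^ 2 := by
  have hcross : 0 ≤ ∑ s ∈ range r, u s * (c s - u s) := by
    have h := mul_sum_range_le_sum_mul hu (e := fun s => c s - u s)
      (fun k => by rw [sum_sub_distrib]; exact sub_nonneg.2 (hdom k)) r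
    rwa [sum_sub_distrib, htot, sub_self, mul_zero] at h
  have hexpand : ∑ s ∈ range r, c s ^ 2 = ∑ s ∈ range r, u s ^ 2 + ∑ s ∈ range r, (c s - u s) ^ 2 +
      2 * ∑ s ∈ range r, u s * (c s - u s) := by
    rw [mul_sum, ← sum_add_distrib, ← sum_add_distrib]
    exact sum_congr rfl fun s _ => by ring
  linarith

variable {D : YoungDiagram} (T : SemistandardYoungTableau D)

theorem content_apply (v : ℕ) : content T v = #{c ∈ D.cells | T c.1 c.2 = v} := by
  rw [content, Finsupp.finsetSum_apply, card_filter]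
  exact sum_congr rfl fun c _ => Finsupp.single_apply

theorem degree_content : (content T).degree = D.cells.card := by
  rw [content, map_sum]
  simp

theorem entry_mem_support_content {c : ℕ × ℕ} (hc : c ∈ D.cells) :
    T c.1 c.2 ∈ (content T).support := by
  rw [Finsupp.mem_support_iff, content_apply, card_ne_zero]
  exact ⟨c, mem_filter.2 ⟨hc, rfl⟩⟩

theorem col_injOn {j i i' : ℕ} (hi : (i, j) ∈ D) (hi' : (i', j) ∈ D) (h : T i j = T i' j) :
    i = i' := by
  rcases lt_trichotomy i i' with hlt | heq | hlt
  · exact absurd h (T.col_strict hlt hi').ne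
  · exact heq
  · exact absurd h (T.col_strict hlt hi).ne'

theorem sum_colLen_le_sum_colCount_content (r : ℕ) :
    ∑ s ∈ range r, D.colLen s ≤ ∑ s ∈ range r, colCount (content T) s := by
  rw [sum_colCount_eq_sum_min, ← card_filter_snd_lt, card_eq_sum_card_fiberwise fun c hc =>
    entry_mem_support_content T (mem_filter.1 hc).1]
  refine sum_le_sum fun v _ => le_min ?_ ?_
  · rw [content_apply]
    exact card_le_card (filter_subset_filter _ (filter_subset _ _))
  · -- an entry occurs at most once in each of the first `r` columns
    refine (card_le_card_of_injOn Prod.snd (t := range r) (fun c hc => ?_) ?_).trans_eq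
      (card_range r)
    · exact mem_coe.2 (mem_range.2 (mem_filter.1 (mem_filter.1 hc).1).2)
    · rintro ⟨i, j⟩ hc ⟨i', j'⟩ hc' (rfl : j = j')
      simp only [coe_filter, mem_filter, Set.mem_ofPred_eq, YoungDiagram.mem_cells] at hc hc'
      rw [col_injOn T hc.1.1 hc'.1.1 (hc.2.trans hc'.2.symm)]

theorem sum_colLen_sq_add_le {r : ℕ} (hr : D.cells.card ≤ r) :
    ∑ s ∈ range r, (D.colLen s : ℤ) ^ 2 +
      ∑ s ∈ range r, ((colCount (content T) s : ℤ) - D.colLen s) ^ 2 ≤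
        ∑ s ∈ range r, (colCount (content T) s : ℤ) ^ 2 := by
  refine sum_sq_add_sum_sq_sub_le_of_dominates ?_ ?_ ?_
  · exact fun s t hst => Nat.cast_le.2 (D.colLen_anti _ _ hst)
  · exact fun k => by exact_mod_cast sum_colLen_le_sum_colCount_content T k
  · have hcount := sum_colCount (content T) ((degree_content T).trans_le hr)
    rw [degree_content, ← sum_colLen D hr] at hcount
    exact_mod_cast hcount.symm

end Dominance

/-! ### Semistandard tableaux with a given content -/

section KeyTableau

theorem lt_card_toFinset_iff {D : YoungDiagram} {d : ℕ →₀ ℕ} (h : ∀ s, D.colLen s = colCount d s)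
    {i j : ℕ} (hf : {v | j < d v}.Finite) : i < #hf.toFinset ↔ (i, j) ∈ D := by
  have hfilter : hf.toFinset = {v ∈ d.support | j < d v} := by
    ext v
    rw [Set.Finite.mem_toFinset, mem_filter, Finsupp.mem_support_iff]
    exact ⟨fun hv : j < d v => ⟨Nat.ne_zero_of_lt hv, hv⟩, And.right⟩
  rw [hfilter, ← colCount, ← h, YoungDiagram.mem_iff_lt_colLen]

/-- The key tableau of content `d`: column `s` consists of the indices `v` with `s < d v`. -/
noncomputable def keyTableau (D : YoungDiagram) (d : ℕ →₀ ℕ) (h : ∀ s, D.colLen s = colCount d s) :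
    SemistandardYoungTableau D where
  entry i j := open Classical in if (i, j) ∈ D then Nat.nth (fun v => j < d v) i else 0
  row_weak' := by
    classical
    intro i j₁ j₂ hj hm
    rw [if_pos (D.up_left_mem le_rfl hj.le hm), if_pos hm, ← Nat.lt_succ_iff]
    refine Nat.nth_lt_of_lt_count (Nat.lt_of_succ_le ?_)
    calc i + 1 = Nat.count (fun v => j₂ < d v) (Nat.nth (fun v => j₂ < d v) i + 1) :=
          (Nat.count_nth_succ fun hf => (lt_card_toFinset_iff h hf).2 hm).symm
      _ ≤ _ := Nat.count_mono_left fun _ _ hk => hj.trans hk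
  col_strict' := by
    classical
    intro i₁ i₂ j hi hm
    rw [if_pos (D.up_left_mem hi.le le_rfl hm), if_pos hm]
    exact Nat.nth_lt_nth' hi fun hf => (lt_card_toFinset_iff h hf).2 hm
  zeros' := fun hm => if_neg hm

theorem content_keyTableau (D : YoungDiagram) (d : ℕ →₀ ℕ) (h : ∀ s, D.colLen s = colCount d s) :
    content (keyTableau D d h) = d := by
  have hentry {i j} (hm : (i, j) ∈ D) : keyTableau D d h i j = Nat.nth (fun v => j < d v) i :=
    if_pos hm
  have hfin (j : ℕ) : {v | j < d v}.Finite := d.support.finite_toSet.subset fun v (hv : j < d v) =>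
    Finsupp.mem_support_iff.2 (Nat.ne_zero_of_lt hv)
  ext v
  rw [content_apply, ← card_range (d v)]
  refine card_bij (fun c _ => c.2) ?_ ?_ ?_
  · rintro ⟨i, j⟩ hc
    rw [mem_filter, YoungDiagram.mem_cells] at hc
    have hlt := Nat.nth_mem i fun hf => (lt_card_toFinset_iff h hf).2 hc.1
    rw [← hentry hc.1, hc.2] at hlt
    exact mem_range.2 hlt
  · rintro ⟨i, j⟩ hc ⟨i', j'⟩ hc' (rfl : j = j')
    rw [mem_filter, YoungDiagram.mem_cells] at hc hc'
    rw [col_injOn _ hc.1 hc'.1 (hc.2.trans hc'.2.symm)]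
  · intro j hj
    obtain ⟨i, hi, hv⟩ := Nat.exists_lt_card_finite_nth_eq (hfin j) (mem_range.1 hj)
    have hm := (lt_card_toFinset_iff h (hfin j)).1 hi
    exact ⟨(i, j), mem_filter.2 ⟨(YoungDiagram.mem_cells _).2 hm, (hentry hm).trans hv⟩, rfl⟩

end KeyTableau

section StandardTableau

variable (D : YoungDiagram) {S : Finset ℕ} (h : #S = #D.cells)

/-- The increasing bijection from the cells, ordered lexicographically, onto `S`. -/
def lexCellsIso : {c // c ∈ D.cells.map toLex.toEmbedding} ≃o {v // v ∈ S} :=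
  ((D.cells.map toLex.toEmbedding).orderIsoOfFin (card_map _)).symm.trans (S.orderIsoOfFin h)

/-- A tableau in which every element of `S` occurs exactly once. -/
noncomputable def standardTableau : SemistandardYoungTableau D where
  entry i j := open Classical in
    if hm : (i, j) ∈ D then lexCellsIso D h ⟨toLex (i, j), by simpa using hm⟩ else 0
  row_weak' := by
    intro i j₁ j₂ hj hm
    rw [dif_pos (D.up_left_mem le_rfl hj.le hm), dif_pos hm]
    exact (lexCellsIso D h).monotone (Prod.Lex.toLex_le_toLex.2 (Or.inr ⟨rfl, hj.le⟩))
  col_strict' := by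
    intro i₁ i₂ j hi hm
    rw [dif_pos (D.up_left_mem hi.le le_rfl hm), dif_pos hm]
    exact (lexCellsIso D h).strictMono (Prod.Lex.toLex_lt_toLex.2 (Or.inl hi))
  zeros' := fun hm => dif_neg hm

theorem content_standardTableau :
    content (standardTableau D h) = ∑ v ∈ S, Finsupp.single v 1 := by
  have hentry (x : {c // c ∈ D.cells.map toLex.toEmbedding}) :
      standardTableau D h (ofLex x.1).1 (ofLex x.1).2 = lexCellsIso D h x :=
    dif_pos ((YoungDiagram.mem_cells _).1 (by simpa using x.2))
  rw [content, ← sum_coe_sort S, ← (lexCellsIso D h).toEquiv.sum_comp]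
  calc ∑ c ∈ D.cells, Finsupp.single (standardTableau D h c.1 c.2) 1
      = ∑ x ∈ D.cells.map toLex.toEmbedding,
          Finsupp.single (standardTableau D h (ofLex x).1 (ofLex x).2) 1 := by rw [sum_map]; rfl
    _ = _ := by
      rw [← sum_coe_sort]
      exact sum_congr rfl fun x _ => congrArg (Finsupp.single · 1) (hentry x)

end StandardTableau

/-! ### The exponents in the Hall pairing -/

section Weights

variable {n : ℕ}

/-- The monomial `x^a q^m` occurs in `s_λ(𝐱𝐲)`: there is a semistandard tableau of shape `λ` in the
variables `x_i q^j` with weight `x^a q^m`. -/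
def IsWeight (lam : n.Partition) (a : ℕ →₀ ℕ) (m : ℕ) : Prop :=
  ∃ (β : ℕ × ℕ →₀ ℕ) (T : SemistandardYoungTableau (diagram lam)), β.mapDomain Prod.fst = a ∧
    (β.sum fun v e => v.2 * e) = m ∧ content T = β.equivMapDomain Nat.pairEquiv

theorem finite_tableaux_of_content (D : YoungDiagram) (d : ℕ →₀ ℕ) :
    Finite {T : SemistandardYoungTableau D // content T = d} := by
  refine Finite.of_injective (β := D.cells → d.support)
    (fun T c => ⟨T.1 c.1.1 c.1.2, by simpa only [T.2] using entry_mem_support_content T.1 c.2⟩) ?_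
  intro T T' h
  ext i j
  by_cases hc : (i, j) ∈ D
  · exact congrArg Subtype.val (congrFun h ⟨(i, j), (YoungDiagram.mem_cells _).2 hc⟩)
  · rw [T.1.zeros hc, T'.1.zeros hc]

theorem finite_exponents (a : ℕ →₀ ℕ) (m : ℕ) : {β : ℕ × ℕ →₀ ℕ |
    β.mapDomain Prod.fst = a ∧ (β.sum fun v e => v.2 * e) = m}.Finite := by
  classical
  refine (Set.finite_Iic (Finsupp.indicator (a.support ×ˢ range (m + 1))
    fun v _ => a v.1 : ℕ × ℕ →₀ ℕ)).subset ?_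
  rintro β ⟨ha, hm⟩ v
  rcases eq_or_ne (β v) 0 with hv | hv
  · exact hv.trans_le (Nat.zero_le _)
  have hsupp : v ∈ β.support := Finsupp.mem_support_iff.2 hv
  have hsnd : v.2 ≤ m := calc
    v.2 ≤ v.2 * β v := Nat.le_mul_of_pos_right _ (Nat.pos_of_ne_zero hv)
    _ ≤ m := hm ▸ single_le_sum (f := fun v : ℕ × ℕ => v.2 * β v) (fun _ _ => Nat.zero_le _) hsupp
  rw [Finsupp.indicator_of_mem (mem_product.2
    ⟨fst_mem_support_of_mapDomain ha hsupp, mem_range.2 (Nat.lt_succ_of_le hsnd)⟩), ← ha,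
    mapDomain_fst_apply]
  exact Finsupp.le_degree v.2 (β.curry v.1)

theorem coeff_schur_ne_zero (lam : n.Partition) (d : ℕ →₀ ℕ) :
    MvPowerSeries.coeff d (schur lam) ≠ 0 ↔
      ∃ T : SemistandardYoungTableau (diagram lam), content T = d := by
  have := finite_tableaux_of_content (diagram lam) d
  change ((Nat.card {T : SemistandardYoungTableau (diagram lam) // content T = d} : ℕ) : ℚ) ≠ 0 ↔ _
  rw [Nat.cast_ne_zero, Nat.card_ne_zero, and_iff_left this, nonempty_subtype]

theorem finsum_coeff_schur_ne_zero (lam : n.Partition) (a : ℕ →₀ ℕ) (m : ℕ) :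
    (∑ᶠ β ∈ {β : ℕ × ℕ →₀ ℕ | β.mapDomain Prod.fst = a ∧ (β.sum fun v e => v.2 * e) = m},
      MvPowerSeries.coeff (β.equivMapDomain Nat.pairEquiv) (schur lam)) ≠ 0 ↔
        IsWeight lam a m := by
  have hnonneg (d : ℕ →₀ ℕ) : 0 ≤ MvPowerSeries.coeff d (schur lam) := Nat.cast_nonneg _
  rw [finsum_mem_eq_finite_toFinset_sum _ (finite_exponents a m), Ne,
    sum_eq_zero_iff_of_nonneg fun _ _ => hnonneg _]
  push Not
  refine exists_congr fun β => ?_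
  rw [coeff_schur_ne_zero, Set.Finite.mem_toFinset]
  exact ⟨fun ⟨h, T, hT⟩ => ⟨T, h.1, h.2, hT⟩, fun ⟨T, h₁, h₂, hT⟩ => ⟨⟨h₁, h₂⟩, T, hT⟩⟩

theorem exists_isWeight (lam ν : n.Partition) : ∃ m, IsWeight lam (exponent ν) m := by
  have hcard : #((diagram ν).cells.map Nat.pairEquiv.toEmbedding) = #(diagram lam).cells := by
    rw [card_map, card_diagram, card_diagram]
  refine ⟨_, ∑ v ∈ (diagram ν).cells, Finsupp.single v 1, standardTableau _ hcard, ?_, rfl, ?_⟩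
  · ext p
    simp_rw [Finsupp.mapDomain_finsetSum, Finsupp.mapDomain_single, Finsupp.finsetSum_apply,
      Finsupp.single_apply]
    rw [← card_filter, exponent_apply, ← rowLen_diagram, YoungDiagram.rowLen_eq_card]
    rfl
  · rw [content_standardTableau, sum_map, Finsupp.equivMapDomain_eq_mapDomain,
      Finsupp.mapDomain_finsetSum]
    exact sum_congr rfl fun v _ => Finsupp.mapDomain_single.symm

theorem degree_exponent (ν : n.Partition) : (exponent ν).degree = n := by
  simpa only [Finsupp.degree_apply, support_exponent, exponent_apply] using sum_part ν

theorem colCount_exponent (ν : n.Partition) (s : ℕ) :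
    colCount (exponent ν) s = (diagram ν).colLen s := by
  simp only [colCount, colLen_diagram_eq_card, support_exponent, exponent_apply]

theorem nStat_eq_sum_exponent (ν : n.Partition) :
    nStat ν = (exponent ν).sum fun j e => j * e := by
  simp only [nStat, Finsupp.sum, support_exponent, exponent_apply]

theorem isWeight_of_colLen_eq_colCount {lam : n.Partition} (β : ℕ × ℕ →₀ ℕ)
    (h : ∀ s, (diagram lam).colLen s = colCount β s) :
    IsWeight lam (β.mapDomain Prod.fst) (β.sum fun v e => v.2 * e) :=
  have h' s := (h s).trans (colCount_equivMapDomain Nat.pairEquiv β s).symm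
  ⟨β, keyTableau _ _ h', rfl, rfl, content_keyTableau _ _ h'⟩

theorem isWeight_of_sum_parts_eq {lam μ : n.Partition} {b : ℕ → ℕ} (ν : ∀ p, (b p).Partition)
    (hb : ∀ p < (rows μ).length, b p = part μ p)
    (h : ∑ p ∈ range (rows μ).length, (ν p).parts = lam.parts) :
    IsWeight lam (exponent μ) (∑ p ∈ range (rows μ).length, nStat (ν p)) := by
  set P := range (rows μ).length
  let γ : ℕ →₀ ℕ →₀ ℕ := Finsupp.indicator P fun p _ => exponent (ν p)
  have hmem {p} (hp : p ∈ P) : γ.uncurry.curry p = exponent (ν p) := by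
    rw [Finsupp.curry_uncurry, Finsupp.indicator_of_mem hp]
  have hsupp : ∀ v ∈ γ.uncurry.support, v.1 ∈ P := by
    intro v hv
    by_contra hp
    have hzero : γ v.1 = 0 := Finsupp.indicator_of_notMem hp _
    exact Finsupp.mem_support_iff.1 hv (DFunLike.congr_fun hzero v.2)
  have hfst : γ.uncurry.mapDomain Prod.fst = exponent μ := by
    ext p
    rw [mapDomain_fst_apply, exponent_apply]
    by_cases hp : p ∈ P
    · rw [hmem hp, degree_exponent, hb p (mem_range.1 hp)]
    · rw [Finsupp.curry_uncurry, Finsupp.indicator_of_notMem hp,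
        part_of_le μ (not_lt.1 fun hlt => hp (mem_range.2 hlt)), map_zero]
  have hsnd : (γ.uncurry.sum fun v e => v.2 * e) = ∑ p ∈ P, nStat (ν p) :=
    (sum_support_eq_sum_curry _ hsupp fun _ j e => j * e).trans
      (sum_congr rfl fun p hp => by rw [nStat_eq_sum_exponent, Finsupp.sum, hmem hp])
  rw [← hfst, ← hsnd]
  refine isWeight_of_colLen_eq_colCount _ fun s => ?_
  rw [colCount_eq_sum_curry _ hsupp, colLen_diagram, ← h, ← Multiset.coe_countPAddMonoidHom,
    map_sum]
  exact sum_congr rfl fun p hp => by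
    rw [hmem hp, colCount_exponent, colLen_diagram, Multiset.coe_countPAddMonoidHom]

/-- In a tableau of weight `x^μ q^m`, `x p s` is the number of `j` such that `x_p q^j` is the entry
of more than `s` cells. -/
theorem IsWeight.exists_columns {lam μ : n.Partition} {m : ℕ} (h : IsWeight lam (exponent μ) m) :
    ∃ x : ℕ → ℕ → ℕ, (∀ p, ∑ s ∈ range n, x p s = part μ p) ∧
      ∑ p ∈ range (rows μ).length, ∑ s ∈ range n, x p s ^ 2 ≤ 2 * m + n ∧
      (colNormSq lam : ℤ) + ∑ s ∈ range n, ((∑ p ∈ range (rows μ).length, (x p s : ℤ)) -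
        (diagram lam).colLen s) ^ 2 ≤
          ∑ s ∈ range n, (∑ p ∈ range (rows μ).length, (x p s : ℤ)) ^ 2 := by
  obtain ⟨β, T, hfst, hsnd, hT⟩ := h
  have hsupp : ∀ v ∈ β.support, v.1 ∈ range (rows μ).length := fun v hv =>
    support_exponent μ ▸ fst_mem_support_of_mapDomain hfst hv
  have hdeg p : (β.curry p).degree = part μ p := by
    rw [← mapDomain_fst_apply, hfst, exponent_apply]
  have hdeg_le p : (β.curry p).degree ≤ n := (hdeg p).trans_le (part_le μ p)
  refine ⟨fun p s => colCount (β.curry p) s, fun p => ?_, ?_, ?_⟩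
  · rw [sum_colCount _ (hdeg_le p), hdeg]
  · calc ∑ p ∈ range (rows μ).length, ∑ s ∈ range n, colCount (β.curry p) s ^ 2
        ≤ ∑ p ∈ range (rows μ).length,
            (2 * ((β.curry p).sum fun j e => j * e) + (β.curry p).degree) :=
          sum_le_sum fun p _ => sum_colCount_sq_le _ (hdeg_le p)
      _ = 2 * m + n := by
          simp_rw [sum_add_distrib, hdeg, sum_part, ← mul_sum]
          rw [← hsnd]
          exact congrArg (2 * · + n)
            (sum_support_eq_sum_curry β hsupp fun _ j e => j * e).symm
  · have hcount s : (colCount (content T) s : ℤ) =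
        ∑ p ∈ range (rows μ).length, (colCount (β.curry p) s : ℤ) := by
      rw [hT, colCount_equivMapDomain, colCount_eq_sum_curry β hsupp, Nat.cast_sum]
    simpa only [hcount, colNormSq, Nat.cast_sum, Nat.cast_pow] using
      sum_colLen_sq_add_le T (card_diagram lam).le

/-- The least `m` for which `x^ν q^m` occurs in `s_λ(𝐱𝐲)`. -/
noncomputable def pairingOrder (lam ν : n.Partition) : ℕ := sInf {m | IsWeight lam (exponent ν) m}

theorem isWeight_pairingOrder (lam ν : n.Partition) :
    IsWeight lam (exponent ν) (pairingOrder lam ν) :=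
  Nat.sInf_mem (exists_isWeight lam ν)

theorem orderTop_ofPowerSeries {R : Type*} [Semiring R] {f : PowerSeries R} {m : ℕ}
    (hm : PowerSeries.coeff m f ≠ 0) (hmin : ∀ j, PowerSeries.coeff j f ≠ 0 → m ≤ j) :
    (HahnSeries.ofPowerSeries ℤ R f).orderTop = (m : ℤ) := by
  refine HahnSeries.orderTop_eq_of_le ?_ fun j hj => ?_
  · rwa [HahnSeries.mem_support, HahnSeries.ofPowerSeries_apply_coeff]
  · rw [HahnSeries.mem_support, PowerSeries.coeff_coe] at hj
    obtain ⟨hj0, hj⟩ := ite_ne_left_iff.1 hj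
    have := hmin _ hj.symm
    omega

theorem orderTop_hallPairing (lam ν : n.Partition) :
    (hallPairing (completeHPart (LaurentSeries ℚ) ν) (evalXY (schur lam))).orderTop =
      (pairingOrder lam ν : ℤ) := by
  rw [hallPairing_completeHPart]
  refine orderTop_ofPowerSeries ?_ fun j hj => ?_
  · rw [PowerSeries.coeff_mk, finsum_coeff_schur_ne_zero]
    exact isWeight_pairingOrder lam ν
  · rw [PowerSeries.coeff_mk, finsum_coeff_schur_ne_zero] at hj
    exact Nat.sInf_le hj

end Weights

/-! ### The quadratic inequality -/

section Quadratic

variable {ι κ K : Type*} [Field K] {P : Finset ι} {S : Finset κ} {x : ι → κ → K} {a : ι → K} {M : K}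

/-- The nonnegative quantity `M n² - n ∑_p a_p² + n ∑_{p,s} x_{ps}² - M ∑_s (∑_p x_{ps})²`, where
`n = ∑_p a_p`. In the application the `a_p` are the parts of a partition, the largest of which is
`M`, and `x_{p0}, x_{p1}, …` are the column lengths of a partition of `a_p`. -/
def defect (P : Finset ι) (S : Finset κ) (x : ι → κ → K) (a : ι → K) (M : K) : K :=
  M * (∑ p ∈ P, a p) ^ 2 - (∑ p ∈ P, a p) * ∑ p ∈ P, a p ^ 2 +
    (∑ p ∈ P, a p) * ∑ p ∈ P, ∑ s ∈ S, x p s ^ 2 - M * ∑ s ∈ S, (∑ p ∈ P, x p s) ^ 2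

theorem mul_sum_sq_sub_div (y : ι → K) (ha : ∀ p ∈ P, a p ≠ 0) (hn : ∑ p ∈ P, a p ≠ 0) :
    (∑ p ∈ P, a p) * ∑ p ∈ P, (y p - a p * (∑ r ∈ P, y r) / ∑ r ∈ P, a r) ^ 2 / a p =
      (∑ p ∈ P, a p) * ∑ p ∈ P, y p ^ 2 / a p - (∑ p ∈ P, y p) ^ 2 := by
  set n := ∑ p ∈ P, a p with hn_def
  set c := ∑ p ∈ P, y p with hc_def
  have hterm : ∀ p ∈ P, (y p - a p * c / n) ^ 2 / a p =
      y p ^ 2 / a p - 2 * c / n * y p + c ^ 2 / n ^ 2 * a p := by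
    intro p hp
    have := ha p hp
    field_simp
    ring
  rw [sum_congr rfl hterm, sum_add_distrib, sum_sub_distrib, ← mul_sum, ← mul_sum, ← hn_def,
    ← hc_def]
  field_simp
  ring

theorem defect_eq (ha : ∀ p ∈ P, a p ≠ 0) (hn : ∑ p ∈ P, a p ≠ 0) :
    defect P S x a M =
      (∑ p ∈ P, a p) * ∑ p ∈ P, (M - a p) / a p * (a p ^ 2 - ∑ s ∈ S, x p s ^ 2) +
        M * ∑ s ∈ S, (∑ p ∈ P, a p) *
          ∑ p ∈ P, (x p s - a p * (∑ r ∈ P, x r s) / ∑ r ∈ P, a r) ^ 2 / a p := by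
  have hfirst : ∑ p ∈ P, (M - a p) / a p * (a p ^ 2 - ∑ s ∈ S, x p s ^ 2) =
      M * ∑ p ∈ P, a p - ∑ p ∈ P, a p ^ 2 - M * (∑ s ∈ S, ∑ p ∈ P, x p s ^ 2 / a p) +
        ∑ p ∈ P, ∑ s ∈ S, x p s ^ 2 := by
    rw [sum_comm (s := S), mul_sum, mul_sum, ← sum_sub_distrib, ← sum_sub_distrib,
      ← sum_add_distrib]
    refine sum_congr rfl fun p hp => ?_
    have := ha p hp
    rw [← sum_div]
    field_simp
    ring
  simp_rw [mul_sum_sq_sub_div _ ha hn, sum_sub_distrib, ← mul_sum, hfirst, defect]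
  ring

variable [LinearOrder K] [IsStrictOrderedRing K]

theorem defect_terms_nonneg (ha : ∀ p ∈ P, 0 < a p) (hM : ∀ p ∈ P, a p ≤ M)
    (hsq : ∀ p ∈ P, ∑ s ∈ S, x p s ^ 2 ≤ a p ^ 2) :
    ∀ p ∈ P, 0 ≤ (M - a p) / a p * (a p ^ 2 - ∑ s ∈ S, x p s ^ 2) :=
  fun p hp => mul_nonneg (div_nonneg (sub_nonneg.2 (hM p hp)) (ha p hp).le)
    (sub_nonneg.2 (hsq p hp))

theorem sum_sq_div_nonneg (y : ι → K) (ha : ∀ p ∈ P, 0 < a p) : 0 ≤ ∑ p ∈ P, y p ^ 2 / a p :=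
  sum_nonneg fun p hp => div_nonneg (sq_nonneg _) (ha p hp).le

theorem defect_nonneg (ha : ∀ p ∈ P, 0 < a p) (hM : ∀ p ∈ P, a p ≤ M)
    (hsq : ∀ p ∈ P, ∑ s ∈ S, x p s ^ 2 ≤ a p ^ 2) : 0 ≤ defect P S x a M := by
  obtain rfl | ⟨p₀, hp₀⟩ := P.eq_empty_or_nonempty
  · simp [defect]
  have hn : 0 < ∑ p ∈ P, a p := sum_pos ha ⟨p₀, hp₀⟩
  have hM0 : 0 < M := (ha p₀ hp₀).trans_le (hM p₀ hp₀)
  rw [defect_eq (fun p hp => (ha p hp).ne') hn.ne']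
  exact add_nonneg (mul_nonneg hn.le (sum_nonneg (defect_terms_nonneg ha hM hsq)))
    (mul_nonneg hM0.le (sum_nonneg fun s _ => mul_nonneg hn.le (sum_sq_div_nonneg _ ha)))

theorem proportional_of_defect_eq_zero (ha : ∀ p ∈ P, 0 < a p) (hM : ∀ p ∈ P, a p ≤ M)
    (hsq : ∀ p ∈ P, ∑ s ∈ S, x p s ^ 2 ≤ a p ^ 2) (h0 : defect P S x a M = 0) :
    (∀ p ∈ P, a p = M ∨ ∑ s ∈ S, x p s ^ 2 = a p ^ 2) ∧
      ∀ p ∈ P, ∀ s ∈ S, (∑ r ∈ P, a r) * x p s = a p * ∑ r ∈ P, x r s := by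
  obtain rfl | ⟨p₀, hp₀⟩ := P.eq_empty_or_nonempty
  · simp
  have hn : 0 < ∑ p ∈ P, a p := sum_pos ha ⟨p₀, hp₀⟩
  have hM0 : 0 < M := (ha p₀ hp₀).trans_le (hM p₀ hp₀)
  have hterms := defect_terms_nonneg ha hM hsq
  have hsquares := fun s (_ : s ∈ S) => mul_nonneg hn.le
    (sum_sq_div_nonneg (fun p => x p s - a p * (∑ r ∈ P, x r s) / ∑ r ∈ P, a r) ha)
  rw [defect_eq (fun p hp => (ha p hp).ne') hn.ne', add_eq_zero_iff_of_nonneg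
    (mul_nonneg hn.le (sum_nonneg hterms)) (mul_nonneg hM0.le (sum_nonneg hsquares)),
    mul_eq_zero_iff_left hn.ne', mul_eq_zero_iff_left hM0.ne',
    sum_eq_zero_iff_of_nonneg hterms, sum_eq_zero_iff_of_nonneg hsquares] at h0
  refine ⟨fun p hp => ?_, fun p hp s hs => ?_⟩
  · refine (mul_eq_zero.1 (h0.1 p hp)).imp (fun h => ?_) fun h => (sub_eq_zero.1 h).symm
    exact (sub_eq_zero.1 ((div_eq_zero_iff.1 h).resolve_right (ha p hp).ne')).symm
  · have hsum := (mul_eq_zero.1 (h0.2 s hs)).resolve_left hn.ne'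
    have hsquare := (sum_eq_zero_iff_of_nonneg fun p hp =>
      div_nonneg (sq_nonneg _) (ha p hp).le).1 hsum p hp
    have hzero := (div_eq_zero_iff.1 hsquare).resolve_right (ha p hp).ne'
    rw [mul_comm, ← eq_div_iff hn.ne']
    exact sub_eq_zero.1 (pow_eq_zero_iff two_ne_zero |>.1 hzero)

theorem sum_sq_eq_of_proportional {p : ι} (hap : a p ≠ 0)
    (hprop : ∀ s ∈ S, (∑ r ∈ P, a r) * x p s = a p * ∑ r ∈ P, x r s)
    (h : ∑ s ∈ S, x p s ^ 2 = a p ^ 2) :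
    ∑ s ∈ S, (∑ r ∈ P, x r s) ^ 2 = (∑ r ∈ P, a r) ^ 2 := by
  refine mul_left_cancel₀ (pow_ne_zero 2 hap) ?_
  calc a p ^ 2 * ∑ s ∈ S, (∑ r ∈ P, x r s) ^ 2
    _ = ∑ s ∈ S, ((∑ r ∈ P, a r) * x p s) ^ 2 := by
      rw [mul_sum]
      exact sum_congr rfl fun s hs => by rw [hprop s hs, mul_pow]
    _ = a p ^ 2 * (∑ r ∈ P, a r) ^ 2 := by
      simp_rw [mul_pow]
      rw [← mul_sum, h, mul_comm]

theorem eq_or_eq_of_defect_eq_zero (ha : ∀ p ∈ P, 0 < a p) (hM : ∀ p ∈ P, a p ≤ M)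
    (hsq : ∀ p ∈ P, ∑ s ∈ S, x p s ^ 2 ≤ a p ^ 2) (h0 : defect P S x a M = 0) :
    ∑ s ∈ S, (∑ p ∈ P, x p s) ^ 2 = (∑ p ∈ P, a p) ^ 2 ∨
      ∀ p ∈ P, a p = M ∧ ∀ s ∈ S, #P * x p s = ∑ r ∈ P, x r s := by
  obtain ⟨hdich, hprop⟩ := proportional_of_defect_eq_zero ha hM hsq h0
  by_cases hall : ∀ p ∈ P, a p = M
  · refine Or.inr fun p hp => ⟨hall p hp, fun s hs => ?_⟩
    have hp' := hprop p hp s hs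
    rw [sum_congr rfl hall, sum_const, nsmul_eq_mul, ← hall p hp] at hp'
    exact mul_left_cancel₀ (ha p hp).ne' (by linear_combination hp')
  · push Not at hall
    obtain ⟨p, hp, hne⟩ := hall
    exact Or.inl (sum_sq_eq_of_proportional (ha p hp).ne' (hprop p hp)
      ((hdich p hp).resolve_left hne))

end Quadratic

/-! ### The quadratic inequality for partitions -/

section Gap

variable {n : ℕ}

/-- The contribution of `μ` to `2 n (v(λ) - v((1^n)))`. -/
noncomputable def gap (lam μ : n.Partition) : ℚ :=
  part μ 0 * ((n : ℚ) ^ 2 - colNormSq lam) -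
    n * (∑ p ∈ range (rows μ).length, (part μ p : ℚ) ^ 2 - (2 * pairingOrder lam μ + n))

theorem exists_defect_add_le_gap (lam μ : n.Partition) :
    ∃ x : ℕ → ℕ → ℕ, (∀ p, ∑ s ∈ range n, x p s = part μ p) ∧
      defect (range (rows μ).length) (range n) (fun p s => (x p s : ℚ)) (fun p => (part μ p : ℚ))
          (part μ 0) +
        part μ 0 * ∑ s ∈ range n,
          (∑ p ∈ range (rows μ).length, (x p s : ℚ) - (diagram lam).colLen s) ^ 2 ≤
      gap lam μ := by
  obtain ⟨x, hx, hrows, hcols⟩ := (isWeight_pairingOrder lam μ).exists_columns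
  refine ⟨x, hx, ?_⟩
  have hsum : ∑ p ∈ range (rows μ).length, (part μ p : ℚ) = n := mod_cast sum_part μ
  have hrows' : ∑ p ∈ range (rows μ).length, ∑ s ∈ range n, (x p s : ℚ) ^ 2 ≤
      2 * pairingOrder lam μ + n := mod_cast hrows
  have hcols' : (colNormSq lam : ℚ) + ∑ s ∈ range n,
      (∑ p ∈ range (rows μ).length, (x p s : ℚ) - (diagram lam).colLen s) ^ 2 ≤
      ∑ s ∈ range n, (∑ p ∈ range (rows μ).length, (x p s : ℚ)) ^ 2 := mod_cast hcols
  have hrows_mul := mul_le_mul_of_nonneg_left hrows' (Nat.cast_nonneg n)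
  have hcols_mul := mul_le_mul_of_nonneg_left hcols' (Nat.cast_nonneg (part μ 0))
  rw [defect, gap, hsum]
  linarith

theorem cast_part_pos (μ : n.Partition) : ∀ p ∈ range (rows μ).length, (0 : ℚ) < part μ p :=
  fun _ hp => mod_cast (part_pos_iff μ).2 (mem_range.1 hp)

theorem cast_part_le (μ : n.Partition) :
    ∀ p ∈ range (rows μ).length, (part μ p : ℚ) ≤ part μ 0 :=
  fun p _ => mod_cast part_anti μ p.zero_le

theorem sum_sq_le_part_sq {μ : n.Partition} {x : ℕ → ℕ → ℕ}
    (hx : ∀ p, ∑ s ∈ range n, x p s = part μ p) :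
    ∀ p ∈ range (rows μ).length, ∑ s ∈ range n, (x p s : ℚ) ^ 2 ≤ (part μ p : ℚ) ^ 2 := by
  intro p _
  rw [← hx p, Nat.cast_sum]
  exact sum_sq_le_sq_sum_of_nonneg fun s _ => Nat.cast_nonneg _

theorem gap_nonneg (lam μ : n.Partition) : 0 ≤ gap lam μ := by
  obtain ⟨x, hx, hgap⟩ := exists_defect_add_le_gap lam μ
  exact (add_nonneg
    (defect_nonneg (cast_part_pos μ) (cast_part_le μ) (sum_sq_le_part_sq hx)) (by positivity)).trans
    hgap

theorem length_rows_pos (hn : 0 < n) (μ : n.Partition) : 0 < (rows μ).length := by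
  by_contra h
  have hsum := sum_part μ
  rw [Nat.eq_zero_of_not_pos h, range_zero, sum_empty] at hsum
  exact hn.ne hsum

theorem colLen_eq_zero_of_le (lam : n.Partition) {s : ℕ} (hs : n ≤ s) :
    (diagram lam).colLen s = 0 := by
  rw [colLen_diagram_eq_card, card_eq_zero, filter_eq_empty_iff]
  exact fun i _ => ((part_le lam i).trans hs).not_gt

theorem exists_columns_of_gap_eq_zero (hn : 0 < n) {lam μ : n.Partition} (h0 : gap lam μ = 0) :
    ∃ x : ℕ → ℕ → ℕ,
      (∀ s ∈ range n, ∑ p ∈ range (rows μ).length, x p s = (diagram lam).colLen s) ∧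
      (∑ s ∈ range n, (∑ p ∈ range (rows μ).length, x p s) ^ 2 = n ^ 2 ∨
        ∀ p ∈ range (rows μ).length, part μ p = part μ 0 ∧
          ∀ s ∈ range n, (rows μ).length * x p s = ∑ r ∈ range (rows μ).length, x r s) := by
  have hM : (0 : ℚ) < part μ 0 := cast_part_pos μ 0 (mem_range.2 (length_rows_pos hn μ))
  obtain ⟨x, hx, hgap⟩ := exists_defect_add_le_gap lam μ
  have hsq := sum_sq_le_part_sq hx
  have hdefect := defect_nonneg (cast_part_pos μ) (cast_part_le μ) hsq
  have hsquares : 0 ≤ ∑ s ∈ range n,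
    (∑ p ∈ range (rows μ).length, (x p s : ℚ) - (diagram lam).colLen s) ^ 2 := by positivity
  have hzero := le_antisymm (hgap.trans_eq h0) (add_nonneg hdefect (mul_nonneg hM.le hsquares))
  rw [add_eq_zero_iff_of_nonneg hdefect (mul_nonneg hM.le hsquares), mul_eq_zero_iff_left hM.ne',
    sum_eq_zero_iff_of_nonneg fun _ _ => sq_nonneg _] at hzero
  refine ⟨x, fun s hs => ?_, ?_⟩
  · exact_mod_cast sub_eq_zero.1 (pow_eq_zero_iff two_ne_zero |>.1 (hzero.2 s hs))
  · have h := eq_or_eq_of_defect_eq_zero (cast_part_pos μ) (cast_part_le μ) hsq hzero.1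
    rw [card_range, ← Nat.cast_sum (range (rows μ).length) (part μ), sum_part μ] at h
    exact_mod_cast h

theorem eq_ones_or_dvd_colLen_of_gap_eq_zero {lam μ : n.Partition} (h0 : gap lam μ = 0) :
    lam = ones n ∨ ((∀ p < (rows μ).length, part μ p = part μ 0) ∧
      ∀ s, (rows μ).length ∣ (diagram lam).colLen s) := by
  obtain rfl | hn := n.eq_zero_or_pos
  · exact Or.inl (Subsingleton.elim _ _)
  obtain ⟨x, hcol, h | h⟩ := exists_columns_of_gap_eq_zero hn h0
  · rw [sum_congr rfl fun s hs => by rw [hcol s hs]] at h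
    exact Or.inl (eq_ones_of_colNormSq h)
  · refine Or.inr ⟨fun p hp => (h p (mem_range.2 hp)).1, fun s => ?_⟩
    obtain hs | hs := lt_or_ge s n
    · rw [← hcol s (mem_range.2 hs),
        ← (h 0 (mem_range.2 (length_rows_pos hn μ))).2 s (mem_range.2 hs)]
      exact dvd_mul_right _ _
    · rw [colLen_eq_zero_of_le lam hs]
      exact dvd_zero _

theorem two_mul_pairingOrder_add_le {lam μ : n.Partition} {b : ℕ → ℕ} (ν : ∀ p, (b p).Partition)
    (hb : ∀ p < (rows μ).length, b p = part μ p)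
    (h : ∑ p ∈ range (rows μ).length, (ν p).parts = lam.parts) :
    2 * pairingOrder lam μ + n ≤ ∑ p ∈ range (rows μ).length, colNormSq (ν p) := by
  have hle : pairingOrder lam μ ≤ ∑ p ∈ range (rows μ).length, nStat (ν p) :=
    Nat.sInf_le (isWeight_of_sum_parts_eq ν hb h)
  simp_rw [← two_mul_nStat_add]
  rw [sum_add_distrib, ← mul_sum, sum_congr rfl fun p hp => hb p (mem_range.1 hp), sum_part]
  lia

theorem sum_parts_ones (μ : n.Partition) :
    ∑ p ∈ range (rows μ).length, (ones (part μ p)).parts = (ones n).parts := by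
  simp only [parts_ones, ← Multiset.replicateAddMonoidHom_apply]
  rw [← map_sum, sum_part]

theorem two_mul_pairingOrder_ones_add (μ : n.Partition) :
    2 * pairingOrder (ones n) μ + n = ∑ p ∈ range (rows μ).length, part μ p ^ 2 := by
  refine le_antisymm ?_ ?_
  · refine (two_mul_pairingOrder_add_le (fun p => ones (part μ p)) (fun _ _ => rfl)
      (sum_parts_ones μ)).trans_eq ?_
    simp only [colNormSq_ones]
  · obtain rfl | hn := n.eq_zero_or_pos
    · simp [fun p => Nat.le_zero.1 (part_le μ p)]
    have h := gap_nonneg (ones n) μ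
    rw [gap, colNormSq_ones, Nat.cast_pow, sub_self, mul_zero, zero_sub, ← mul_neg] at h
    have h' := nonneg_of_mul_nonneg_right h (Nat.cast_pos.2 hn)
    exact_mod_cast (by linarith : ∑ p ∈ range (rows μ).length, (part μ p : ℚ) ^ 2 ≤
      2 * pairingOrder (ones n) μ + n)

theorem colNormSq_of_parts_eq_nsmul {b ℓ : ℕ} {lam : n.Partition} {ν : b.Partition} (hb : b ≤ n)
    (h : lam.parts = ℓ • ν.parts) : colNormSq lam = ℓ ^ 2 * colNormSq ν := by
  have hν : colNormSq ν = ∑ s ∈ range n, (diagram ν).colLen s ^ 2 :=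
    sum_subset (range_mono hb) fun s _ hs => by
      rw [colLen_eq_zero_of_le ν (by simpa using hs), zero_pow two_ne_zero]
  rw [hν, colNormSq, mul_sum]
  refine sum_congr rfl fun s _ => ?_
  rw [colLen_diagram, h, Multiset.countP_nsmul, ← colLen_diagram, mul_pow]

theorem gap_eq_zero_of_parts_eq_nsmul {lam μ : n.Partition}
    (hrect : ∀ p < (rows μ).length, part μ p = part μ 0) {ν : (part μ 0).Partition}
    (hν : lam.parts = (rows μ).length • ν.parts) : gap lam μ = 0 := by
  refine le_antisymm ?_ (gap_nonneg lam μ)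
  have hle := two_mul_pairingOrder_add_le (lam := lam) (fun _ => ν)
    (fun p hp => (hrect p hp).symm) (by rw [sum_const, card_range, hν])
  have hsum := sum_part μ
  have hrect' : ∀ p ∈ range (rows μ).length, part μ p = part μ 0 :=
    fun p hp => hrect p (mem_range.1 hp)
  rw [sum_congr rfl hrect', sum_const, card_range, smul_eq_mul] at hsum
  rw [sum_const, card_range, smul_eq_mul] at hle
  have hle' : (2 * pairingOrder lam μ + n : ℚ) ≤ (rows μ).length * colNormSq ν := mod_cast hle
  have hmul := mul_le_mul_of_nonneg_left hle' (Nat.cast_nonneg n)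
  have hsum' : (n : ℚ) = (rows μ).length * part μ 0 := mod_cast hsum.symm
  rw [gap, colNormSq_of_parts_eq_nsmul (part_le μ 0) hν,
    sum_congr rfl fun p hp => by rw [hrect' p hp], sum_const, card_range, nsmul_eq_mul]
  push_cast
  linear_combination hmul + (part μ 0 * n + colNormSq ν * (rows μ).length : ℚ) * hsum'

end Gap

/-! ### Valuations -/

section Order

theorem order_eq_of_orderTop_eq {Γ R : Type*} [PartialOrder Γ] [Zero Γ] [Zero R]
    {x : HahnSeries Γ R} {m : Γ} (h : x.orderTop = m) : x ≠ 0 ∧ x.order = m := by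
  have hx : x ≠ 0 := HahnSeries.orderTop_ne_top.1 (h ▸ WithTop.coe_ne_top)
  exact ⟨hx, WithTop.coe_injective ((HahnSeries.order_eq_orderTop_of_ne_zero hx).trans h)⟩

variable {Γ R : Type*} [AddCommGroup Γ] [LinearOrder Γ] [IsOrderedAddMonoid Γ] [Field R]

theorem order_inv (x : HahnSeries Γ R) : x⁻¹.order = -x.order := by
  obtain rfl | hx := eq_or_ne x 0
  · simp
  · rw [eq_neg_iff_add_eq_zero, add_comm, ← HahnSeries.order_mul hx (inv_ne_zero hx),
      mul_inv_cancel₀ hx, HahnSeries.order_one]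

theorem order_zpow (x : HahnSeries Γ R) : ∀ z : ℤ, (x ^ z).order = z • x.order
  | (m : ℕ) => by rw [zpow_natCast, HahnSeries.order_pow, natCast_zsmul]
  | .negSucc m => by rw [zpow_negSucc, order_inv, HahnSeries.order_pow, negSucc_zsmul]

theorem order_prod {ι : Type*} (s : Finset ι) (f : ι → HahnSeries Γ R) (hf : ∀ i ∈ s, f i ≠ 0) :
    (∏ i ∈ s, f i).order = ∑ i ∈ s, (f i).order := by
  induction s using Finset.cons_induction with
  | empty => simp
  | cons i s hi ih =>
    rw [forall_mem_cons] at hf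
    rw [prod_cons, sum_cons, HahnSeries.order_mul hf.1 (prod_ne_zero_iff.2 hf.2), ih hf.2]

end Order

section Valuation

variable {k n : ℕ}

theorem qVar_ne_zero : qVar ≠ 0 :=
  HahnSeries.single_ne_zero one_ne_zero

theorem order_qVar : qVar.order = 1 :=
  HahnSeries.order_single one_ne_zero

theorem orderTop_hookPoly (lam : n.Partition) : (hookPoly lam).orderTop = (0 : ℤ) := by
  have h : hookPoly lam = HahnSeries.ofPowerSeries ℤ ℚ (∏ c ∈ (diagram lam).cells,
      (1 - PowerSeries.X ^ hookLength (diagram lam) c)) := by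
    simp only [hookPoly, qVar, map_prod, map_sub, map_one, map_pow, HahnSeries.ofPowerSeries_X]
  rw [h]
  refine orderTop_ofPowerSeries (m := 0) ?_ fun _ _ => Nat.zero_le _
  rw [PowerSeries.coeff_zero_eq_constantCoeff_apply, map_prod, prod_ne_zero_iff]
  intro c _
  simp [hookLength]

theorem hookPoly_ne_zero (lam : n.Partition) : hookPoly lam ≠ 0 :=
  (order_eq_of_orderTop_eq (orderTop_hookPoly lam)).1

variable (g : ℕ) (μ : Fin k → n.Partition) (lam : n.Partition)

theorem hallPairing_schur_ne_zero (ν : n.Partition) :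
    hallPairing (completeHPart (LaurentSeries ℚ) ν) (evalXY (schur lam)) ≠ 0 :=
  (order_eq_of_orderTop_eq (orderTop_hallPairing lam ν)).1

theorem calA_ne_zero : calA g μ lam ≠ 0 :=
  mul_ne_zero (mul_ne_zero (zpow_ne_zero _ qVar_ne_zero) (zpow_ne_zero _
    (mul_ne_zero (zpow_ne_zero _ qVar_ne_zero) (hookPoly_ne_zero lam))))
    (prod_ne_zero_iff.2 fun i _ => hallPairing_schur_ne_zero lam (μ i))

theorem valuationA_eq : valuationA g μ lam =
    (1 - (g : ℤ)) * n - (2 * (g : ℤ) + k - 2) * nStat lam + ∑ i, (pairingOrder lam (μ i) : ℤ) := by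
  have hq := fun z : ℤ => zpow_ne_zero z qVar_ne_zero
  have hbase := mul_ne_zero (hq (-(nStat lam : ℤ))) (hookPoly_ne_zero lam)
  have hpair := fun i (_ : i ∈ univ) => hallPairing_schur_ne_zero lam (μ i)
  rw [valuationA, calA, HahnSeries.order_mul (mul_ne_zero (hq _) (zpow_ne_zero _ hbase))
      (prod_ne_zero_iff.2 hpair), HahnSeries.order_mul (hq _) (zpow_ne_zero _ hbase),
    order_zpow, order_zpow, HahnSeries.order_mul (hq _) (hookPoly_ne_zero lam), order_zpow,
    (order_eq_of_orderTop_eq (orderTop_hookPoly lam)).2, order_qVar, order_prod _ _ hpair,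
    sum_congr rfl fun i _ => (order_eq_of_orderTop_eq (orderTop_hallPairing lam (μ i))).2]
  simp only [smul_eq_mul]
  ring

theorem two_mul_valuationA : 2 * (valuationA g μ lam : ℚ) =
    ∑ i, (2 * (pairingOrder lam (μ i) : ℚ) + n) - (2 * (g : ℚ) - 2 + k) * colNormSq lam := by
  rw [valuationA_eq, ← two_mul_nStat_add, sum_add_distrib, ← mul_sum, sum_const, card_univ,
    Fintype.card_fin, nsmul_eq_mul]
  push_cast
  ring

theorem valuationA_ones : (valuationA g μ (ones n) : ℚ) = -bigDelta g μ := by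
  have hpair : ∀ i, 2 * (pairingOrder (ones n) (μ i) : ℚ) + n =
      ∑ p ∈ range (rows (μ i)).length, (part (μ i) p : ℚ) ^ 2 :=
    fun i => mod_cast two_mul_pairingOrder_ones_add (μ i)
  have h := two_mul_valuationA g μ (ones n)
  rw [colNormSq_ones, sum_congr rfl fun i _ => hpair i] at h
  push_cast at h
  rw [bigDelta]
  linear_combination h / 2

theorem valuationA_sub_valuationA_ones :
    2 * (n : ℚ) * (valuationA g μ lam - valuationA g μ (ones n)) =
      smallDelta g μ * ((n : ℚ) ^ 2 - colNormSq lam) + ∑ i, gap lam (μ i) := by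
  have hgap : ∑ i, gap lam (μ i) =
      (∑ i, (part (μ i) 0 : ℚ)) * ((n : ℚ) ^ 2 - colNormSq lam) -
        n * (∑ i, ∑ p ∈ range (rows (μ i)).length, (part (μ i) p : ℚ) ^ 2 -
          ∑ i, (2 * (pairingOrder lam (μ i) : ℚ) + n)) := by
    simp only [gap, sum_sub_distrib, ← mul_sum, sum_mul]
  rw [hgap, valuationA_ones, smallDelta, bigDelta]
  push_cast
  linear_combination (n : ℚ) * two_mul_valuationA g μ lam

theorem smallDelta_mul_nonneg {g : ℕ} {μ : Fin k → n.Partition} (hδ : 0 ≤ smallDelta g μ) :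
    0 ≤ (smallDelta g μ : ℚ) * ((n : ℚ) ^ 2 - colNormSq lam) := by
  have hle : colNormSq lam ≤ n ^ 2 := by
    rw [colNormSq]
    conv_rhs => rw [← sum_colLen_diagram lam]
    exact sum_sq_le_sq_sum_of_nonneg fun _ _ => Nat.zero_le _
  exact mul_nonneg (mod_cast hδ) (sub_nonneg.2 (mod_cast hle))

variable {g μ lam}

theorem valuationA_ones_le (hδ : 0 ≤ smallDelta g μ) (lam : n.Partition) :
    valuationA g μ (ones n) ≤ valuationA g μ lam := by
  obtain rfl | hn := n.eq_zero_or_pos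
  · rw [Subsingleton.elim lam (ones 0)]
  have h := add_nonneg (smallDelta_mul_nonneg lam hδ)
    (sum_nonneg fun i (_ : i ∈ univ) => gap_nonneg lam (μ i))
  rw [← valuationA_sub_valuationA_ones] at h
  exact_mod_cast sub_nonneg.1 (nonneg_of_mul_nonneg_right h (by positivity))

theorem isMin_iff (hδ : 0 ≤ smallDelta g μ) :
    (∀ κ : n.Partition, valuationA g μ lam ≤ valuationA g μ κ) ↔
      valuationA g μ lam = valuationA g μ (ones n) :=
  ⟨fun h => le_antisymm (h _) (valuationA_ones_le hδ lam),
    fun h κ => h.trans_le (valuationA_ones_le hδ κ)⟩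

/-- All parts of every `μ^i` are equal. -/
def Rectangular (μ : Fin k → n.Partition) : Prop :=
  ∀ i, ∀ p < (rows (μ i)).length, part (μ i) p = part (μ i) 0

/-- The least common multiple of the lengths of the `μ^i`. -/
def lcmLength (μ : Fin k → n.Partition) : ℕ :=
  univ.lcm fun i => (rows (μ i)).length

theorem rectangular_of_valuationA_eq (hδ : 0 ≤ smallDelta g μ)
    (h : valuationA g μ lam = valuationA g μ (ones n)) (hne : lam ≠ ones n) :
    smallDelta g μ = 0 ∧ Rectangular μ ∧ ∀ s, lcmLength μ ∣ (diagram lam).colLen s := by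
  have hgap : ∀ i ∈ univ, 0 ≤ gap lam (μ i) := fun i _ => gap_nonneg lam (μ i)
  have hsum := (valuationA_sub_valuationA_ones g μ lam).symm
  rw [h, sub_self, mul_zero, add_eq_zero_iff_of_nonneg (smallDelta_mul_nonneg lam hδ)
    (sum_nonneg hgap), sum_eq_zero_iff_of_nonneg hgap] at hsum
  have hnorm : (n : ℚ) ^ 2 - colNormSq lam ≠ 0 := fun h0 =>
    hne (eq_ones_of_colNormSq (mod_cast (sub_eq_zero.1 h0).symm))
  have hrect := fun i =>
    (eq_ones_or_dvd_colLen_of_gap_eq_zero (hsum.2 i (mem_univ i))).resolve_left hne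
  exact ⟨mod_cast (mul_eq_zero.1 hsum.1).resolve_right hnorm, fun i => (hrect i).1,
    fun s => lcm_dvd fun i _ => (hrect i).2 s⟩

theorem length_mul_part (hrect : Rectangular μ) (i : Fin k) :
    (rows (μ i)).length * part (μ i) 0 = n := by
  have hsum := sum_part (μ i)
  rwa [sum_congr rfl fun p hp => hrect i p (mem_range.1 hp), sum_const, card_range,
    smul_eq_mul] at hsum

theorem lcmLength_dvd (hrect : Rectangular μ) : lcmLength μ ∣ n :=
  lcm_dvd fun i _ => Dvd.intro _ (length_mul_part hrect i)

theorem gap_eq_zero_of_parts_eq_lcmLength_nsmul (hn : 0 < n) (hrect : Rectangular μ) {t : ℕ}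
    {lam₀ : t.Partition} (h : lam.parts = lcmLength μ • lam₀.parts) (i : Fin k) :
    gap lam (μ i) = 0 := by
  obtain ⟨e, he⟩ : (rows (μ i)).length ∣ lcmLength μ := dvd_lcm (mem_univ i)
  have hsum : (e • lam₀.parts).sum = part (μ i) 0 := by
    have hparts := congrArg Multiset.sum h
    rw [lam.parts_sum, he, mul_smul, Multiset.sum_nsmul, smul_eq_mul] at hparts
    exact Nat.eq_of_mul_eq_mul_left (length_rows_pos hn (μ i))
      (hparts.symm.trans (length_mul_part hrect i).symm)
  refine gap_eq_zero_of_parts_eq_nsmul (hrect i)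
    (ν := ⟨e • lam₀.parts, fun ha => lam₀.parts_pos (Multiset.mem_of_mem_nsmul ha), hsum⟩) ?_
  rw [h, he, mul_smul]

theorem valuationA_eq_of_parts_eq_nsmul (hδ : smallDelta g μ = 0) (hrect : Rectangular μ)
    {t : ℕ} {lam₀ : t.Partition} (h : lam.parts = lcmLength μ • lam₀.parts) :
    valuationA g μ lam = valuationA g μ (ones n) := by
  obtain rfl | hn := n.eq_zero_or_pos
  · rw [Subsingleton.elim lam (ones 0)]
  have hsub := valuationA_sub_valuationA_ones g μ lam
  rw [hδ, sum_eq_zero fun i _ => gap_eq_zero_of_parts_eq_lcmLength_nsmul hn hrect h i,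
    Int.cast_zero, zero_mul, add_zero, mul_eq_zero_iff_left (by positivity), sub_eq_zero] at hsub
  exact_mod_cast hsub

theorem exists_parts_eq_nsmul {L t : ℕ} (hL : 0 < L) (hLt : n = L * t)
    (h : ∀ s, L ∣ (diagram lam).colLen s) : ∃ lam₀ : t.Partition, lam.parts = L • lam₀.parts := by
  have hcount : ∀ a ∈ lam.parts, L ∣ lam.parts.count a := by
    intro a ha
    obtain ⟨r, rfl⟩ := Nat.exists_eq_succ_of_ne_zero (lam.parts_pos ha).ne'
    exact (Nat.dvd_add_left (h (r + 1))).1 (count_parts_add_colLen lam r ▸ h r)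
  obtain ⟨u, hu⟩ := Multiset.exists_smul_of_dvd_count _ hcount
  have hsum := lam.parts_sum
  rw [hu, Multiset.sum_nsmul, smul_eq_mul, hLt] at hsum
  refine ⟨⟨u, fun {a} ha => lam.parts_pos ?_, Nat.eq_of_mul_eq_mul_left hL hsum⟩, hu⟩
  exact hu ▸ (Multiset.mem_nsmul_of_ne_zero hL.ne').2 ha

theorem valuationA_eq_ones_iff (hδ : smallDelta g μ = 0) (hrect : Rectangular μ) {t : ℕ}
    (ht : n = lcmLength μ * t) : valuationA g μ lam = valuationA g μ (ones n) ↔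
      ∃ lam₀ : t.Partition, lam.parts = lcmLength μ • lam₀.parts := by
  refine ⟨fun h => ?_, fun ⟨_, h⟩ => valuationA_eq_of_parts_eq_nsmul hδ hrect h⟩
  by_cases hne : lam = ones n
  · exact ⟨ones t, by rw [hne, parts_ones, parts_ones, Multiset.nsmul_replicate, ← ht]⟩
  have hn : 0 < n := Nat.pos_of_ne_zero fun hn => hne (by subst hn; exact Subsingleton.elim _ _)
  exact exists_parts_eq_nsmul (Nat.pos_of_dvd_of_pos (lcmLength_dvd hrect) hn) ht
    (rectangular_of_valuationA_eq hδ.ge h hne).2.2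

end Valuation

end SymFun

namespace FinQuiver

open Finset

/-! ### Radical vectors and imaginary roots -/

attribute [instance] FinQuiver.fintypeArrow

section Matrix

variable {I R : Type*} [Fintype I]

theorem two_mul_dotProduct_mulVec_mul [CommRing R] {A : Matrix I I R} (hA : A.IsSymm) {v : I → R}
    (hv : A.mulVec v = 0) (y : I → R) :
    2 * ((v * y) ⬝ᵥ A.mulVec (v * y)) =
      -∑ i, ∑ j, A i j * (v i * v j * (y i - y j) ^ 2) := by
  have hrow : ∑ i, ∑ j, v i * y i ^ 2 * (A i j * v j) = 0 :=
    sum_eq_zero fun i _ => by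
      rw [← mul_sum, show ∑ j, A i j * v j = 0 from congrFun hv i, mul_zero]
  have hcol : ∑ i, ∑ j, v j * y j ^ 2 * (A j i * v i) = 0 := by rw [sum_comm, hrow]
  have hterm : ∀ i j, A i j * (v i * v j * (y i - y j) ^ 2) =
      v i * y i ^ 2 * (A i j * v j) + v j * y j ^ 2 * (A j i * v i) -
        2 * (v i * y i * (A i j * (v j * y j))) := fun i j => by
    rw [hA.apply i j]
    ring
  simp only [hterm, sum_sub_distrib, sum_add_distrib, hrow, hcol]
  simp only [← mul_sum, dotProduct, Matrix.mulVec, Pi.mul_apply]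
  ring

theorem dotProduct_mulVec_nonneg [Field R] [LinearOrder R] [IsStrictOrderedRing R]
    {A : Matrix I I R} (hA : A.IsSymm) (hoff : ∀ i j, i ≠ j → A i j ≤ 0) {v : I → R}
    (hpos : ∀ i, 0 < v i) (hv : A.mulVec v = 0) (x : I → R) : 0 ≤ x ⬝ᵥ A.mulVec x := by
  have hx : x = v * (x / v) := funext fun i => (mul_div_cancel₀ (x i) (hpos i).ne').symm
  have hsum := two_mul_dotProduct_mulVec_mul hA hv (x / v)
  rw [← hx] at hsum
  refine nonneg_of_mul_nonneg_right (hsum ▸ neg_nonneg.2 ?_) two_pos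
  refine sum_nonpos fun i _ => sum_nonpos fun j _ => ?_
  obtain rfl | hij := eq_or_ne i j
  · simp
  · exact mul_nonpos_of_nonpos_of_nonneg (hoff i j hij)
      (mul_nonneg (mul_pos (hpos i) (hpos j)).le (sq_nonneg _))

end Matrix

variable {I : Type} [DecidableEq I] (Q : FinQuiver I)

theorem cartan_apply (i j : I) : Q.cartan i j = (if i = j then 2 else 0) -
    (#{a : Q.Arrow | Q.tail a = i ∧ Q.head a = j} : ℤ) -
    (#{a : Q.Arrow | Q.tail a = j ∧ Q.head a = i} : ℤ) := by
  have hedges : Q.numEdges i j = #{a : Q.Arrow | (Q.tail a = i ∧ Q.head a = j) ∨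
      (Q.tail a = j ∧ Q.head a = i)} := by
    rw [numEdges, Nat.card_eq_fintype_card, Fintype.card_subtype]
  unfold cartan
  split_ifs with hij
  · subst hij
    rw [hedges]
    simp only [or_self]
    ring
  · classical
    rw [hedges, filter_or, card_union_of_disjoint (disjoint_filter.2 fun a _ h h' =>
      hij (h.1.symm.trans h'.1))]
    push_cast
    ring

theorem cartan_isSymm : Q.cartan.IsSymm := by
  refine Matrix.IsSymm.ext fun i j => ?_
  rw [cartan_apply, cartan_apply]
  simp only [eq_comm (a := i) (b := j)]
  ring

theorem cartan_nonpos {i j : I} (h : i ≠ j) : Q.cartan i j ≤ 0 := by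
  rw [cartan_apply, if_neg h]
  lia

theorem cartan_self_le (i : I) : Q.cartan i i ≤ 2 := by
  rw [cartan_apply, if_pos rfl]
  lia

variable [Fintype I]

theorem cartan_mulVec (u : I → ℤ) (i : I) : Q.cartan.mulVec u i = 2 * u i -
    (∑ a : Q.Arrow, if Q.tail a = i then u (Q.head a) else 0) -
    ∑ a : Q.Arrow, if Q.head a = i then u (Q.tail a) else 0 := by
  have hcount : ∀ f f' : Q.Arrow → I, ∑ j, (#{a : Q.Arrow | f a = i ∧ f' a = j} : ℤ) * u j =
      ∑ a : Q.Arrow, if f a = i then u (f' a) else 0 := by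
    intro f f'
    simp_rw [card_filter, Nat.cast_sum, sum_mul]
    rw [sum_comm]
    refine sum_congr rfl fun a _ => ?_
    rw [sum_eq_single (f' a) (fun j _ hj => by simp [hj.symm]) (by simp)]
    simp
  simp only [Matrix.mulVec, dotProduct, cartan_apply, sub_mul, sum_sub_distrib, ite_mul, zero_mul,
    sum_ite_eq, mem_univ, if_true, hcount]
  simp only [and_comm, hcount]

theorem titsForm_add (x y : I → ℤ) :
    Q.titsForm (x + y) = Q.titsForm x + 2 * (y ⬝ᵥ Q.cartan.mulVec x) + Q.titsForm y := by
  have hsymm : x ⬝ᵥ Q.cartan.mulVec y = y ⬝ᵥ Q.cartan.mulVec x := by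
    rw [Matrix.dotProduct_mulVec, ← Matrix.mulVec_transpose, Q.cartan_isSymm, dotProduct_comm]
  rw [titsForm, Matrix.mulVec_add, add_dotProduct, dotProduct_add, dotProduct_add, hsymm, titsForm,
    titsForm]
  ring

theorem titsForm_smul (c : ℤ) (x : I → ℤ) : Q.titsForm (c • x) = c ^ 2 * Q.titsForm x := by
  rw [titsForm, titsForm, Matrix.mulVec_smul, smul_dotProduct, dotProduct_smul, smul_eq_mul,
    smul_eq_mul]
  ring

theorem titsForm_single (i : I) : Q.titsForm (Pi.single i 1) = Q.cartan i i := by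
  rw [titsForm, single_dotProduct, one_mul, Matrix.mulVec_single_one, Matrix.col_apply]

theorem titsForm_nonneg_of_mulVec_eq_zero {v : I → ℤ} (hpos : ∀ i, 0 < v i)
    (hv : Q.cartan.mulVec v = 0) (x : I → ℤ) : 0 ≤ Q.titsForm x := by
  let A : Matrix I I ℚ := Q.cartan.map (Int.castRingHom ℚ)
  have hA : A.mulVec (fun i => (v i : ℚ)) = 0 := by
    ext i
    exact (RingHom.map_mulVec (Int.castRingHom ℚ) Q.cartan v i).symm.trans (by simp [hv])
  have hcast : ((Q.titsForm x : ℤ) : ℚ) = (fun i => (x i : ℚ)) ⬝ᵥ A.mulVec fun i => (x i : ℚ) := by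
    simp [titsForm, dotProduct, Matrix.mulVec, A]
  have hnonneg := dotProduct_mulVec_nonneg (Q.cartan_isSymm.map _)
    (fun i j hij => Int.cast_nonpos.2 (Q.cartan_nonpos hij)) (fun i => Int.cast_pos.2 (hpos i)) hA
    fun i => (x i : ℚ)
  exact_mod_cast hcast ▸ hnonneg

variable {Q}

theorem IsFundamental.mulVec_eq_zero (hQ : ∀ x, 0 ≤ Q.titsForm x) {u : I → ℤ}
    (hu : Q.IsFundamental u) : Q.cartan.mulVec u = 0 := by
  obtain ⟨hu0, -, -, hCu⟩ := hu
  have hform : Q.titsForm u ≤ 0 := sum_nonpos fun i _ =>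
    mul_nonpos_of_nonneg_of_nonpos (hu0 i) (hCu i)
  refine funext fun i => le_antisymm (hCu i) ?_
  -- the form at `2 u + e_i` is at most `4 (C u)_i + 2`, which is negative unless `(C u)_i = 0`
  have htest := hQ ((2 : ℤ) • u + Pi.single i 1)
  rw [titsForm_add, titsForm_smul, titsForm_single, Matrix.mulVec_smul, dotProduct_smul,
    single_dotProduct, one_mul, smul_eq_mul] at htest
  have hdiag := Q.cartan_self_le i
  rw [Pi.zero_apply]
  lia

theorem IsPosImaginaryRoot.isFundamental (hQ : ∀ x, 0 ≤ Q.titsForm x) {u : I → ℤ}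
    (hu : Q.IsPosImaginaryRoot u) : Q.IsFundamental u := by
  induction hu with
  | fundamental _ hu => exact hu
  | reflection i _ u _ ih =>
    rwa [reflect, ih.mulVec_eq_zero hQ, Pi.zero_apply, Pi.single_zero, sub_zero]

theorem isFundamental_of_pos {w : I → ℤ} (hconn : Q.graph.Connected) (hw : ∀ i, 0 < w i)
    (hCw : Q.cartan.mulVec w = 0) : Q.IsFundamental w := by
  have hsupport : {i | w i ≠ 0} = Set.univ := Set.eq_univ_of_forall fun i => (hw i).ne'
  refine ⟨fun i => (hw i).le, ?_, ?_, fun i => by rw [hCw]; exact le_rfl⟩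
  · obtain ⟨i⟩ := hconn.nonempty
    exact fun h => (hw i).ne' (congrFun h i)
  · rw [hsupport]
    exact (SimpleGraph.induceUnivIso Q.graph).connected_iff.2 hconn

theorem IsBasicImaginaryRoot.unique {u w : I → ℤ} (hu : Q.IsBasicImaginaryRoot u)
    (hw : Q.IsBasicImaginaryRoot w) : u = w := by
  obtain ⟨s, -, hs⟩ := (hw u).1 ((hu u).2 ⟨1, le_rfl, (one_smul ℕ u).symm⟩)
  obtain ⟨t, -, ht⟩ := (hu w).1 ((hw w).2 ⟨1, le_rfl, (one_smul ℕ w).symm⟩)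
  obtain rfl | hu0 := eq_or_ne u 0
  · rw [ht, smul_zero]
  · have hst : ((s * t : ℕ) : ℤ) • u = (1 : ℤ) • u := by
      rw [natCast_zsmul, mul_smul, ← ht, ← hs, one_smul]
    have hst' : s * t = 1 := by exact_mod_cast smul_left_injective ℤ hu0 hst
    rw [hs, Nat.eq_one_of_mul_eq_one_right hst', one_smul]

end FinQuiver

namespace SymFun

open Finset

/-! ### The comet-shaped quiver -/

section Comet

variable {n k : ℕ} {μ : Fin k → n.Partition} {g : ℕ}

/-- The values of `u` along the `i`-th leg: `legValue u i j` is the value at the vertex `[i, j]`,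
where `[i, 0]` is the central vertex and `u` is continued by `0` beyond the end of the leg. -/
def legValue (u : CometVertex μ → ℤ) (i : Fin k) : ℕ → ℤ
  | 0 => u none
  | j + 1 => if h : j < (rows (μ i)).length - 1 then u (some ⟨i, ⟨j, h⟩⟩) else 0

theorem legValue_succ (u : CometVertex μ → ℤ) (p : Leg μ) :
    legValue u p.1 (p.2 + 1) = u (some p) :=
  dif_pos p.2.2

theorem legValue_length (hn : 0 < n) (u : CometVertex μ → ℤ) (i : Fin k) :
    legValue u i (rows (μ i)).length = 0 := by
  obtain ⟨l, hl⟩ := Nat.exists_eq_succ_of_ne_zero (length_rows_pos hn (μ i)).ne'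
  rw [hl, legValue, dif_neg (by lia)]

theorem sum_leg_ite (u : CometVertex μ → ℤ) (i : Fin k) (j : ℕ) :
    (∑ q : Fin ((rows (μ i)).length - 1), if (q : ℕ) = j then u (some ⟨i, q⟩) else 0) =
      legValue u i (j + 1) := by
  rw [legValue]
  split_ifs with hj
  · rw [sum_eq_single ⟨j, hj⟩ (fun q _ hq => if_neg fun h => hq (Fin.ext h)) (by simp), if_pos rfl]
  · exact sum_eq_zero fun q _ => if_neg fun h : (q : ℕ) = j => hj (h ▸ q.2)

theorem apply_head_inr (u : CometVertex μ → ℤ) (p : Leg μ) :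
    u ((cometQuiver g μ).head (Sum.inr p)) = legValue u p.1 p.2 := by
  obtain ⟨i, _ | j, hj⟩ := p
  · rfl
  · exact (legValue_succ u ⟨i, ⟨j, Nat.lt_of_succ_lt hj⟩⟩).symm

theorem head_inr_eq_some_iff (p q : Leg μ) :
    (cometQuiver g μ).head (Sum.inr p) = some q ↔ p.1 = q.1 ∧ (p.2 : ℕ) = q.2 + 1 := by
  obtain ⟨i, _ | j, hj⟩ := p
  · simp [cometQuiver]
  · obtain ⟨i', j', hj'⟩ := q
    simp only [cometQuiver, Option.some.injEq, Sigma.mk.injEq, Nat.add_right_cancel_iff]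
    refine and_congr_right fun hi => ?_
    subst hi
    rw [heq_eq_eq, Fin.mk.injEq]

theorem head_inr_eq_none_iff (p : Leg μ) :
    (cometQuiver g μ).head (Sum.inr p) = none ↔ (p.2 : ℕ) = 0 := by
  obtain ⟨i, _ | j, hj⟩ := p <;> simp [cometQuiver]

theorem sum_arrow (f : (cometQuiver g μ).Arrow → ℤ) :
    ∑ a, f a = ∑ a : Fin g, f (Sum.inl a) + ∑ p : Leg μ, f (Sum.inr p) :=
  Fintype.sum_sum_type f

variable (g) in
theorem cartan_mulVec_some (u : CometVertex μ → ℤ) (p : Leg μ) :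
    (cometQuiver g μ).cartan.mulVec u (some p) =
      2 * legValue u p.1 (p.2 + 1) - legValue u p.1 p.2 - legValue u p.1 (p.2 + 2) := by
  have hout : (∑ q : Leg μ, if (cometQuiver g μ).tail (Sum.inr q) = some p
      then u ((cometQuiver g μ).head (Sum.inr q)) else 0) = legValue u p.1 p.2 := by
    simp [cometQuiver, ← apply_head_inr (g := g)]
  have hin : (∑ q : Leg μ, if (cometQuiver g μ).head (Sum.inr q) = some p
      then u ((cometQuiver g μ).tail (Sum.inr q)) else 0) = legValue u p.1 (p.2 + 2) := by
    simp only [head_inr_eq_some_iff, Fintype.sum_sigma]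
    rw [sum_eq_single p.1 (fun i _ hi => by simp [hi]) (by simp)]
    simp only [true_and]
    exact sum_leg_ite u p.1 (p.2 + 1)
  have hloop (b : Fin g) : (cometQuiver g μ).tail (Sum.inl b) ≠ some p ∧
      (cometQuiver g μ).head (Sum.inl b) ≠ some p := ⟨nofun, nofun⟩
  rw [FinQuiver.cartan_mulVec, sum_arrow, sum_arrow, hout, hin, legValue_succ]
  simp only [if_neg (hloop _).1, if_neg (hloop _).2, sum_const_zero, zero_add]

variable (g) in
theorem cartan_mulVec_none (u : CometVertex μ → ℤ) :
    (cometQuiver g μ).cartan.mulVec u none = (2 - 2 * g) * u none - ∑ i, legValue u i 1 := by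
  have hin : (∑ q : Leg μ, if (cometQuiver g μ).head (Sum.inr q) = none
      then u ((cometQuiver g μ).tail (Sum.inr q)) else 0) = ∑ i, legValue u i 1 := by
    simp only [head_inr_eq_none_iff, Fintype.sum_sigma]
    exact sum_congr rfl fun i _ => sum_leg_ite u i 0
  rw [FinQuiver.cartan_mulVec, sum_arrow, sum_arrow, hin]
  simp only [cometQuiver, if_true, reduceCtorEq, if_false, sum_const, card_univ, Fintype.card_fin,
    nsmul_eq_mul, mul_zero, add_zero]
  ring

variable (g μ) in
theorem comet_connected : (cometQuiver g μ).graph.Connected := by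
  have hadj (p : Leg μ) :
      (cometQuiver g μ).graph.Reachable ((cometQuiver g μ).head (Sum.inr p)) (some p) := by
    refine SimpleGraph.Adj.reachable ((SimpleGraph.fromRel_adj _ _ _).2
      ⟨fun h => ?_, Or.inr ⟨Sum.inr p, rfl, rfl⟩⟩)
    have := ((head_inr_eq_some_iff p p).1 h).2
    lia
  refine (SimpleGraph.connected_iff_exists_forall_reachable _).2 ⟨none, ?_⟩
  rintro (_ | ⟨i, j, hj⟩)
  · exact SimpleGraph.Reachable.refl _
  induction j with
  | zero => exact hadj ⟨i, ⟨0, hj⟩⟩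
  | succ j ih => exact (ih (Nat.lt_of_succ_lt hj)).trans (hadj ⟨i, ⟨j + 1, hj⟩⟩)

theorem sum_range_part_of_le (ν : n.Partition) {j : ℕ} (hj : (rows ν).length ≤ j) :
    ∑ r ∈ range j, part ν r = n :=
  (sum_subset (range_subset_range.2 hj) fun r _ hr =>
    part_of_le ν (by simpa using hr)).symm.trans (sum_part ν)

theorem legValue_dimVector (i : Fin k) (j : ℕ) :
    legValue (dimVector μ) i j = n - ∑ r ∈ range j, (part (μ i) r : ℤ) := by
  rcases j with _ | j
  · simp [legValue, dimVector]
  · rw [legValue]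
    split_ifs with hj
    · rfl
    · rw [← Nat.cast_sum, sum_range_part_of_le (μ i) (by lia), sub_self]

variable (g) in
theorem cartan_mulVec_dimVector_none :
    (cometQuiver g μ).cartan.mulVec (dimVector μ) none = -smallDelta g μ := by
  simp only [cartan_mulVec_none, legValue_dimVector, dimVector, smallDelta, sum_range_one,
    sum_sub_distrib, sum_const, card_univ, Fintype.card_fin, nsmul_eq_mul]
  ring

variable (g) in
theorem cartan_mulVec_dimVector_some (p : Leg μ) :
    (cometQuiver g μ).cartan.mulVec (dimVector μ) (some p) =
      part (μ p.1) (p.2 + 1) - part (μ p.1) p.2 := by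
  simp only [cartan_mulVec_some, legValue_dimVector, sum_range_succ]
  ring

theorem cartan_mulVec_dimVector_eq_zero_iff :
    (cometQuiver g μ).cartan.mulVec (dimVector μ) = 0 ↔ smallDelta g μ = 0 ∧ Rectangular μ := by
  constructor
  · refine fun h => ⟨?_, fun i p => ?_⟩
    · have hnone := congrFun h none
      rwa [cartan_mulVec_dimVector_none, Pi.zero_apply, neg_eq_zero] at hnone
    · induction p with
      | zero => exact fun _ => rfl
      | succ p ih =>
        intro hp
        have hsome := congrFun h (some ⟨i, ⟨p, by lia⟩⟩)
        rw [cartan_mulVec_dimVector_some, Pi.zero_apply, sub_eq_zero] at hsome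
        exact (Nat.cast_inj.1 hsome).trans (ih (by lia))
  · rintro ⟨hδ, hrect⟩
    funext x
    rcases x with _ | ⟨i, j, hj⟩
    · rw [cartan_mulVec_dimVector_none, hδ, neg_zero, Pi.zero_apply]
    · rw [cartan_mulVec_dimVector_some, hrect i (j + 1) (by lia), hrect i j (by lia), sub_self,
        Pi.zero_apply]

section Radical

variable {u w : CometVertex μ → ℤ}

theorem legValue_of_mulVec_eq_zero (hu : (cometQuiver g μ).cartan.mulVec u = 0) (i : Fin k) {j : ℕ}
    (hj : j ≤ (rows (μ i)).length) :
    legValue u i j = u none - j * (u none - legValue u i 1) := by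
  induction j using Nat.twoStepInduction with
  | zero => simp [legValue]
  | one => simp
  | more j ih ih' =>
    have hsome := congrFun hu (some ⟨i, ⟨j, by lia⟩⟩)
    rw [cartan_mulVec_some, ih (by lia), ih' (by lia), Pi.zero_apply] at hsome
    push_cast at hsome ⊢
    linarith

theorem length_mul_legValue (hn : 0 < n) (hu : (cometQuiver g μ).cartan.mulVec u = 0) (i : Fin k)
    {j : ℕ} (hj : j ≤ (rows (μ i)).length) :
    (rows (μ i)).length * legValue u i j = ((rows (μ i)).length - j) * u none := by
  have hend := legValue_of_mulVec_eq_zero hu i le_rfl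
  rw [legValue_length hn] at hend
  rw [legValue_of_mulVec_eq_zero hu i hj]
  linear_combination -(j : ℤ) * hend

theorem lcmLength_dvd_apply_none (hn : 0 < n) (hu : (cometQuiver g μ).cartan.mulVec u = 0) :
    (lcmLength μ : ℤ) ∣ u none := by
  refine Int.natCast_dvd.2 (lcm_dvd fun i _ => Int.natCast_dvd.1 ?_)
  have hend := legValue_of_mulVec_eq_zero hu i le_rfl
  rw [legValue_length hn, eq_comm, sub_eq_zero] at hend
  exact Dvd.intro _ hend.symm

theorem eq_smul_of_mulVec_eq_zero (hn : 0 < n) (hu : (cometQuiver g μ).cartan.mulVec u = 0)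
    (hw : (cometQuiver g μ).cartan.mulVec w = 0) {s : ℤ} (h : u none = s * w none) : u = s • w := by
  funext x
  rcases x with _ | p
  · exact h
  have hp : (p.2 : ℕ) + 1 ≤ (rows (μ p.1)).length := by lia
  have hlen : ((rows (μ p.1)).length : ℤ) ≠ 0 := mod_cast (length_rows_pos hn (μ p.1)).ne'
  rw [Pi.smul_apply, smul_eq_mul, ← legValue_succ u p, ← legValue_succ w p]
  refine mul_left_cancel₀ hlen ?_
  rw [length_mul_legValue hn hu p.1 hp, mul_left_comm, length_mul_legValue hn hw p.1 hp, h]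
  ring

end Radical

theorem lcmLength_pos (hn : 0 < n) : 0 < lcmLength μ :=
  Nat.pos_of_ne_zero fun h => by
    obtain ⟨i, -, hi⟩ := Finset.lcm_eq_zero_iff.1 h
    exact (length_rows_pos hn (μ i)).ne' hi

variable (μ) in
/-- The vector with value `L = lcm(l(μ^1), …, l(μ^k))` at the central vertex that decreases
linearly along each leg and would vanish one step beyond its end. When `δ(μ) = 0` and all `μ^i` are
rectangular, this is the basic positive imaginary root `𝐯^*`. -/
def primitiveVector : CometVertex μ → ℤ
  | none => lcmLength μ
  | some p => lcmLength μ - (p.2 + 1) * (lcmLength μ / (rows (μ p.1)).length : ℕ)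

theorem primitiveVector_pos (hn : 0 < n) (x : CometVertex μ) : 0 < primitiveVector μ x := by
  have hL : 0 < lcmLength μ := lcmLength_pos hn
  rcases x with _ | p
  · exact Int.natCast_pos.2 hL
  have hdvd : (rows (μ p.1)).length ∣ lcmLength μ := dvd_lcm (mem_univ p.1)
  have hmul := Nat.mul_div_cancel' hdvd
  have hlt : ((p.2 : ℕ) + 1) * (lcmLength μ / (rows (μ p.1)).length) < lcmLength μ := by
    conv_rhs => rw [← hmul]
    exact Nat.mul_lt_mul_of_pos_right (by lia)
      (Nat.div_pos (Nat.le_of_dvd hL hdvd) (length_rows_pos hn _))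
  exact sub_pos.2 (mod_cast hlt)

theorem dimVector_eq_smul_primitiveVector (hrect : Rectangular μ) {t : ℕ}
    (ht : n = lcmLength μ * t) : dimVector μ = t • primitiveVector μ := by
  have htZ : (n : ℤ) = lcmLength μ * t := mod_cast ht
  funext x
  rw [Pi.smul_apply, nsmul_eq_mul]
  rcases x with _ | ⟨i, j, hj⟩
  · exact htZ.trans (mul_comm _ _)
  have hlen : 0 < (rows (μ i)).length := by lia
  have hpart : part (μ i) 0 = t * (lcmLength μ / (rows (μ i)).length) := by
    have hdvd : (rows (μ i)).length ∣ lcmLength μ := dvd_lcm (mem_univ i)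
    refine Nat.eq_of_mul_eq_mul_left hlen ?_
    rw [length_mul_part hrect i, mul_left_comm, Nat.mul_div_cancel' hdvd, mul_comm, ← ht]
  have hsum : ∑ r ∈ range (j + 1), (part (μ i) r : ℤ) = (j + 1) * part (μ i) 0 := by
    rw [sum_congr rfl fun r hr => by rw [hrect i r (by have := mem_range.1 hr; lia)]]
    simp
  simp only [dimVector, primitiveVector, hsum, hpart, htZ]
  push_cast
  ring

theorem cartan_mulVec_primitiveVector (hn : 0 < n) (hδ : smallDelta g μ = 0)
    (hrect : Rectangular μ) : (cometQuiver g μ).cartan.mulVec (primitiveVector μ) = 0 := by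
  obtain ⟨t, ht⟩ := lcmLength_dvd hrect
  have hC := cartan_mulVec_dimVector_eq_zero_iff.2 ⟨hδ, hrect⟩
  rw [dimVector_eq_smul_primitiveVector hrect ht, Matrix.mulVec_smul] at hC
  exact (smul_eq_zero.1 hC).resolve_left (right_ne_zero_of_mul (ht ▸ hn.ne'))

theorem isAffine_of_rectangular (hn : 0 < n) (hδ : smallDelta g μ = 0) (hrect : Rectangular μ) :
    (cometQuiver g μ).IsAffine := by
  have hC := cartan_mulVec_primitiveVector hn hδ hrect
  refine ⟨comet_connected μ g, FinQuiver.titsForm_nonneg_of_mulVec_eq_zero _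
    (primitiveVector_pos hn) hC, primitiveVector μ, ?_, ?_⟩
  · exact fun h => (primitiveVector_pos hn none).ne' (congrFun h none)
  · rw [FinQuiver.titsForm, hC, dotProduct_zero]

theorem isBasicImaginaryRoot_primitiveVector (hn : 0 < n) (hδ : smallDelta g μ = 0)
    (hrect : Rectangular μ) : (cometQuiver g μ).IsBasicImaginaryRoot (primitiveVector μ) := by
  have hC := cartan_mulVec_primitiveVector hn hδ hrect
  have hpsd := (isAffine_of_rectangular hn hδ hrect).2.1
  refine fun u => ⟨fun hu => ?_, ?_⟩
  · have hfund := hu.isFundamental hpsd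
    have hCu := hfund.mulVec_eq_zero hpsd
    obtain ⟨s, hs⟩ := lcmLength_dvd_apply_none hn hCu
    have hus : u = s • primitiveVector μ :=
      eq_smul_of_mulVec_eq_zero hn hCu hC (hs.trans (mul_comm _ _))
    have hs0 : 0 ≤ s := nonneg_of_mul_nonneg_right (hs ▸ hfund.1 none)
      (Int.natCast_pos.2 (lcmLength_pos hn))
    lift s to ℕ using hs0
    rw [natCast_zsmul] at hus
    refine ⟨s, Nat.one_le_iff_ne_zero.2 fun h0 => hfund.2.1 ?_, hus⟩
    rw [hus, h0, zero_smul]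
  · rintro ⟨t, ht, rfl⟩
    refine .fundamental _ (FinQuiver.isFundamental_of_pos (comet_connected μ g)
      (fun x => nsmul_pos (primitiveVector_pos hn x) (by lia)) ?_)
    rw [Matrix.mulVec_smul, hC, smul_zero]

theorem exists_isBasicImaginaryRoot (hn : 0 < n) (hδ : smallDelta g μ = 0)
    (hrect : Rectangular μ) : ∃ (vstar : CometVertex μ → ℤ) (t : ℕ),
      (cometQuiver g μ).IsBasicImaginaryRoot vstar ∧ 1 ≤ t ∧ dimVector μ = t • vstar := by
  obtain ⟨t, ht⟩ := lcmLength_dvd hrect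
  exact ⟨primitiveVector μ, t, isBasicImaginaryRoot_primitiveVector hn hδ hrect,
    Nat.pos_of_mul_pos_left (ht ▸ hn), dimVector_eq_smul_primitiveVector hrect ht⟩

section Affine

variable {vstar : CometVertex μ → ℤ} {t : ℕ}

theorem pos_of_dimVector_eq_smul (haff : (cometQuiver g μ).IsAffine)
    (hbasic : (cometQuiver g μ).IsBasicImaginaryRoot vstar) (ht : 1 ≤ t)
    (hv : dimVector μ = t • vstar) : 0 < n := by
  have himag := (hbasic vstar).2 ⟨1, le_rfl, (one_smul ℕ vstar).symm⟩
  refine Nat.pos_of_ne_zero fun hn => (himag.isFundamental haff.2.1).2.1 ?_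
  have hdim : dimVector μ = 0 := by
    funext x
    rcases x with _ | ⟨i, j, hj⟩
    · exact Int.natCast_eq_zero.2 hn
    · have hpart : ∀ r, part (μ i) r = 0 := fun r => Nat.le_zero.1 (hn ▸ part_le (μ i) r)
      simp [dimVector, hpart, hn]
  exact (smul_eq_zero.1 (hv.symm.trans hdim)).resolve_left (by lia)

theorem rectangular_of_isAffine (haff : (cometQuiver g μ).IsAffine)
    (hbasic : (cometQuiver g μ).IsBasicImaginaryRoot vstar) (hv : dimVector μ = t • vstar) :
    smallDelta g μ = 0 ∧ Rectangular μ := by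
  have himag := (hbasic vstar).2 ⟨1, le_rfl, (one_smul ℕ vstar).symm⟩
  refine cartan_mulVec_dimVector_eq_zero_iff.1 ?_
  rw [hv, Matrix.mulVec_smul, (himag.isFundamental haff.2.1).mulVec_eq_zero haff.2.1, smul_zero]

theorem eq_lcmLength_mul (hn : 0 < n) (haff : (cometQuiver g μ).IsAffine)
    (hbasic : (cometQuiver g μ).IsBasicImaginaryRoot vstar) (hv : dimVector μ = t • vstar) :
    n = lcmLength μ * t := by
  obtain ⟨hδ, hrect⟩ := rectangular_of_isAffine haff hbasic hv
  rw [hbasic.unique (isBasicImaginaryRoot_primitiveVector hn hδ hrect)] at hv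
  have hnone : (n : ℤ) = t • (lcmLength μ : ℤ) := congrFun hv none
  rw [nsmul_eq_mul, mul_comm] at hnone
  exact_mod_cast hnone

end Affine

end Comet

end SymFun

theorem theorem5p10 (g k n : ℕ) (μ : Fin k → n.Partition) (hδ : 0 ≤ SymFun.smallDelta g μ) :
    -- every `𝒜_{λμ}(q)` is nonzero, so that `v(λ)` is defined
    (∀ lam : n.Partition, SymFun.calA g μ lam ≠ 0) ∧
    -- the minimum of `v` is `v((1^n)) = -Δ(μ)`
    IsLeast (Set.range (SymFun.valuationA g μ)) (SymFun.valuationA g μ (SymFun.ones n)) ∧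
    (SymFun.valuationA g μ (SymFun.ones n) : ℚ) = -SymFun.bigDelta g μ ∧
    -- affine case
    (∀ (vstar : SymFun.CometVertex μ → ℤ) (t : ℕ), (SymFun.cometQuiver g μ).IsAffine →
      (SymFun.cometQuiver g μ).IsBasicImaginaryRoot vstar → 1 ≤ t →
      SymFun.dimVector μ = t • vstar →
        t ∣ n ∧ ∀ lam : n.Partition,
          (∀ κ : n.Partition, SymFun.valuationA g μ lam ≤ SymFun.valuationA g μ κ) ↔
            ∃ lam₀ : t.Partition, lam.parts = (n / t) • lam₀.parts) ∧
    -- all other cases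
    (¬ ((SymFun.cometQuiver g μ).IsAffine ∧
        ∃ (vstar : SymFun.CometVertex μ → ℤ) (t : ℕ),
          (SymFun.cometQuiver g μ).IsBasicImaginaryRoot vstar ∧ 1 ≤ t ∧
          SymFun.dimVector μ = t • vstar) →
      ∀ lam : n.Partition,
        (∀ κ : n.Partition, SymFun.valuationA g μ lam ≤ SymFun.valuationA g μ κ) ↔
          lam = SymFun.ones n) := by
  refine ⟨SymFun.calA_ne_zero g μ, ⟨Set.mem_range_self _, ?_⟩, SymFun.valuationA_ones g μ,
    fun vstar t haff hbasic ht hv => ?_, fun hnot lam => ?_⟩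
  · rintro _ ⟨lam, rfl⟩
    exact SymFun.valuationA_ones_le hδ lam
  · have hn : 0 < n := SymFun.pos_of_dimVector_eq_smul haff hbasic ht hv
    obtain ⟨hδ0, hrect⟩ := SymFun.rectangular_of_isAffine haff hbasic hv
    have hnt : n = SymFun.lcmLength μ * t := SymFun.eq_lcmLength_mul hn haff hbasic hv
    refine ⟨Dvd.intro_left _ hnt.symm, fun lam => ?_⟩
    rw [SymFun.isMin_iff hδ, Nat.div_eq_of_eq_mul_left ht hnt]
    exact SymFun.valuationA_eq_ones_iff hδ0 hrect hnt
  · rw [SymFun.isMin_iff hδ]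
    refine ⟨fun h => by_contra fun hne => hnot ?_, congrArg _⟩
    obtain ⟨hδ0, hrect, -⟩ := SymFun.rectangular_of_valuationA_eq hδ h hne
    have hn : 0 < n := Nat.pos_of_ne_zero (by rintro rfl; exact hne (Subsingleton.elim _ _))
    exact ⟨SymFun.isAffine_of_rectangular hn hδ0 hrect,
      SymFun.exists_isBasicImaginaryRoot hn hδ0 hrect⟩
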